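/- Let $S=[-\tfrac12,\tfrac12]^2$ be the unit square, $d$ the Euclidean distance, and let $X_1,X_2,\dots$ be i.i.d. random points of $S$ whose common law has a density $f$ with $\epsilon_1\le f(x)\le\epsilon_2$ for all $x\in S$, where $0<\epsilon_1\le\epsilon_2<\infty$ are constants. Let $h:S\times S\to[0,\infty)$ be a deterministic measurable function with $c_1 d(x,y)\le h(x,y)=h(y,x)\le c_2 d(x,y)$ for all $x,y\in S$, where $c_1,c_2>0$ are constants ($h$ need not be a metric). For $\alpha>0$ give the edge between $X_i$ and $X_j$ the weight $h(X_i,X_j)^{\alpha}$, and let $TSP_n$ be the minimum, over all cycles visiting each of the nodes $X_1,\dots,X_n$ exactly once, of the sum of the weights of the edges of the cycle. Suppose that there is a square $S_0\subseteq S$ with side length $s_0>0$ (not depending on $n$) such that, for $u,v\in S$, $h(u,v)=d(u,v)$ whenever $u\in S_0$ or $v\in S_0$. Then for every $0<\alpha<1$ there is a constant $D>0$, not depending on $n$, such that $$\operatorname{var}(TSP_n)\ \ge\ D\,n^{1-\alpha}\qquad\text{for all sufficiently large } n.$$ -/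

import Mathlib

open MeasureTheory ProbabilityTheory Filter

/-- The Euclidean plane. -/
abbrev Plane : Type := EuclideanSpace ℝ (Fin 2)

/-- The unit square `[-1/2, 1/2]²`. -/
def unitSquare : Set Plane := {x | ∀ i, x i ∈ Set.Icc (-(1 / 2) : ℝ) (1 / 2)}

/-- `Q` is a (closed) square of side length `s`, in any position and orientation: the image of
`[0, s]²` under an isometry of the plane. -/
def IsSquareOfSide (s : ℝ) (Q : Set Plane) : Prop :=
  ∃ e : Plane ≃ᵃⁱ[ℝ] Plane, Q = e '' {x : Plane | ∀ i, x i ∈ Set.Icc (0 : ℝ) s}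

/-- The law on the plane that has density `f` on the unit square and no mass outside it. -/
noncomputable def nodeLaw (f : Plane → ℝ) : Measure Plane :=
  (volume.restrict unitSquare).withDensity fun x => ENNReal.ofReal (f x)

/-- The weight, with edge weight function `h` and exponent `α`, of the spanning cycle
`(x (σ 0), x (σ 1), …, x (σ (n - 1)), x (σ 0))` through the nodes `x 0, …, x (n - 1)`. Here
`finRotate n` is the cyclic successor `k ↦ k + 1` on `Fin n`. -/
noncomputable def cycleWeight (h : Plane → Plane → ℝ) (α : ℝ) {n : ℕ} (x : Fin n → Plane)
    (σ : Equiv.Perm (Fin n)) : ℝ :=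
  ∑ k : Fin n, h (x (σ k)) (x (σ (finRotate n k))) ^ α

/-- The minimum weight of a spanning cycle through the nodes `x 0, …, x (n - 1)`. -/
noncomputable def tspWeight (h : Plane → Plane → ℝ) (α : ℝ) {n : ℕ} (x : Fin n → Plane) : ℝ :=
  (Finset.univ : Finset (Equiv.Perm (Fin n))).inf' Finset.univ_nonempty (cycleWeight h α x)

/-! The variance is bounded below by Cauchy–Schwarz: for a test function `φ` of mean zero, `(E[T
φ])² ≤ var T · E[φ²]`, where `T` is the minimum weight. It suffices to find `φ` with `E[T φ] ≥ c
n^(-α/2)` and `E[φ²] ≤ C / n`.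

In the central half of `S₀` take about `n` disjoint cells of side `r = θ / √n`. In each cell fix
three small subsquares: a base part `A`, a far part `B` at distance of order `r` from `A` and from
the outside of the cell, and a near part `B'` adjacent to `A`. For a cell and an ordered pair `(a,
b)` of nodes, the test function requires `x a ∈ A`, no node other than `a` and `b` in the cell, and
weights `x b` by a signed combination of the indicators of `B` and `B'` with integral zero. These
functions are pairwise orthogonal (`integral_pairProd_mul_eq_zero`), so their sum `φ` has second
moment at most of order `n³ · n⁻⁴`.

For the correlation, move `x b` from `B` to `B'`. Cutting the isolated node `b` out of an optimal
cycle saves at least `(1 - α)(r / 4)^α`, because `t ↦ t^α` is strictly concave, and putting it back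
beside `a` costs at most `2 (3 δ r)^α`, which is at most half of that when `δ` is small
(`tspWeight_update_le_of_isolated`). The saving needs the triangle inequality for the edge that
bypasses `b`. Since `h` is not a metric, this is available only if a neighbour of `b` lies in `S₀`.
The nodes whose successor is outside `S₀` are few: each uses an edge of length at least `s₀ / 4`,
while `T = o(n)` uniformly (`exists_tspWeight_le`), and each such move costs only `O(r^α)`. Hence
`E[T φ]` is at least of order `r^α`, and the variance at least of order `n · r^(2α)`, that is, `n^(1
- α)`. The bookkeeping is in `IsCellFamily.sq_le_variance_mul`. -/

/-! ### Walks and spanning cycles -/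

section Walks

open scoped Fin.NatCast Fin.CommRing

/-- The weight of a walk: the sum of `w` over the pairs of consecutive nodes. -/
def walkWeight {V : Type*} (w : V → V → ℝ) : List V → ℝ
  | [] => 0
  | [_] => 0
  | a :: b :: l => w a b + walkWeight w (b :: l)

lemma walkWeight_append_cons {V : Type*} (w : V → V → ℝ) (l₁ : List V) (b : V) (l₂ : List V) :
    walkWeight w (l₁ ++ b :: l₂) = walkWeight w (l₁ ++ [b]) + walkWeight w (b :: l₂) := by
  induction l₁ with
  | nil => simp [walkWeight]
  | cons a l ih =>
    cases l with
    | nil => simp [walkWeight]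
    | cons c l => simp only [List.cons_append, walkWeight] at ih ⊢; linarith

lemma walkWeight_append_cons_cons {V : Type*} (w : V → V → ℝ) (l₁ : List V) (p s : V)
    (l₂ : List V) :
    walkWeight w (l₁ ++ p :: s :: l₂) =
      walkWeight w (l₁ ++ [p]) + w p s + walkWeight w (s :: l₂) := by
  rw [walkWeight_append_cons, walkWeight]; ring

lemma walkWeight_map_range {V : Type*} (w : V → V → ℝ) (g : ℕ → V) (m : ℕ) :
    walkWeight w ((List.range (m + 1)).map g) =
      ∑ i ∈ Finset.range m, w (g i) (g (i + 1)) := by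
  induction m with
  | zero => simp [walkWeight]
  | succ m ih =>
    rw [Finset.sum_range_succ, ← ih, List.range_succ, List.range_succ]
    simp only [List.map_append, List.map_cons, List.map_nil, List.append_assoc,
      List.singleton_append]
    rw [walkWeight_append_cons_cons]
    simp [walkWeight]

lemma walkWeight_congr {V : Type*} {w w' : V → V → ℝ} {l : List V}
    (hw : ∀ a ∈ l, ∀ b ∈ l, w a b = w' a b) : walkWeight w l = walkWeight w' l := by
  induction l with
  | nil => rfl
  | cons a l ih =>
    cases l with
    | nil => rfl
    | cons b l =>
      simp only [walkWeight]
      rw [hw a (by simp) b (by simp), ih]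
      intro c hc d hd
      exact hw c (List.mem_cons_of_mem _ hc) d (List.mem_cons_of_mem _ hd)

/-- The walk has `m + 2` entries because it returns to its starting node. The shift `c` lets the
reading begin at any position of the cycle. -/
lemma sum_perm_finRotate_eq_walkWeight {m : ℕ} (w : Fin (m + 1) → Fin (m + 1) → ℝ)
    (σ : Equiv.Perm (Fin (m + 1))) (c : Fin (m + 1)) :
    ∑ k, w (σ k) (σ (finRotate (m + 1) k)) =
      walkWeight w ((List.range (m + 2)).map fun i : ℕ => σ ((i : Fin (m + 1)) + c)) := by
  rw [walkWeight_map_range, ← Equiv.sum_comp (Equiv.addRight c), Finset.sum_range]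
  refine Finset.sum_congr rfl fun k _ => ?_
  simp only [finRotate_apply, Equiv.coe_addRight, Fin.cast_val_eq_self, Nat.cast_add, Nat.cast_one]
  rw [add_right_comm]

lemma tspWeight_le_walkWeight (h : Plane → Plane → ℝ) (α : ℝ) {n : ℕ} (x : Fin n → Plane)
    (a : Fin n) (l : List (Fin n)) (hnd : (a :: l).Nodup) (hlen : (a :: l).length = n) :
    tspWeight h α x ≤ walkWeight (fun i j => h (x i) (x j) ^ α) (a :: (l ++ [a])) := by
  obtain _ | m := n
  · exact a.elim0
  have hinj : Function.Injective fun k : Fin (m + 1) => (a :: l)[(k : ℕ)]'(by omega) := by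
    intro i j hij
    exact Fin.ext ((List.Nodup.getElem_inj_iff hnd).1 hij)
  set σ : Equiv.Perm (Fin (m + 1)) :=
    Equiv.ofBijective _ (Finite.injective_iff_bijective.1 hinj) with hσ
  have hle : tspWeight h α x ≤ cycleWeight h α x σ := Finset.inf'_le _ (Finset.mem_univ σ)
  refine hle.trans (le_of_eq ?_)
  rw [cycleWeight, sum_perm_finRotate_eq_walkWeight (fun i j => h (x i) (x j) ^ α) σ 0]
  congr 1
  rw [List.range_succ, List.map_append, ← List.cons_append]
  congr 1
  · apply List.ext_getElem (by simpa using hlen.symm)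
    intro i h1 h2
    have hi : i < m + 1 := by omega
    simp [hσ, Nat.mod_eq_of_lt hi]
  · simp [hσ]

/-- A spanning cycle, read off from the node `a` on, with the node `b` singled out. -/
lemma exists_split_cycle {n : ℕ} (σ : Equiv.Perm (Fin n)) {a b : Fin n} (hab : a ≠ b) :
    ∃ m₁ m₂ l : List (Fin n), (a :: (m₁ ++ b :: m₂)).Nodup ∧ (a :: (m₁ ++ b :: m₂)).length = n ∧
      m₂ ++ [a] = σ (finRotate n (σ.symm b)) :: l ∧
      ∀ w : Fin n → Fin n → ℝ, ∑ k, w (σ k) (σ (finRotate n k)) =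
        walkWeight w (a :: (m₁ ++ b :: (m₂ ++ [a]))) := by
  obtain _ | m := n
  · exact a.elim0
  set c := σ.symm a with hc
  set g : ℕ → Fin (m + 1) := fun i => σ ((i : Fin (m + 1)) + c) with hg
  have hg0 : g 0 = a := by simp [hg, hc]
  have hnd : ((List.range (m + 1)).map g).Nodup := by
    refine List.Nodup.map_on ?_ List.nodup_range
    intro i hi j hj hij
    have := congrArg Fin.val (add_right_cancel (σ.injective hij))
    rw [List.mem_range] at hi hj
    simpa [Nat.mod_eq_of_lt hi, Nat.mod_eq_of_lt hj] using this
  have hb : b ∈ (List.range (m + 1)).map g := by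
    refine List.mem_map.2 ⟨(σ.symm b - c : Fin (m + 1)).val, List.mem_range.2 (Fin.is_lt _), ?_⟩
    simp [hg]
  have hL : (List.range (m + 1)).map g = a :: ((List.range m).map fun i => g (i + 1)) := by
    rw [List.range_succ_eq_map]; simp [hg0, Function.comp_def]
  rw [hL] at hb
  have hb' := (List.mem_cons.1 hb).resolve_left hab.symm
  obtain ⟨m₁, m₂, hm⟩ := List.append_of_mem hb'
  rw [hm] at hL
  have hlast : (List.range (m + 2)).map g = a :: (m₁ ++ b :: (m₂ ++ [a])) := by
    rw [List.range_succ, List.map_append, hL]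
    simp [hg, hc]
  obtain ⟨s, l, hsl⟩ : ∃ s l, m₂ ++ [a] = s :: l := by
    cases m₂ with
    | nil => exact ⟨a, [], rfl⟩
    | cons s l => exact ⟨s, l ++ [a], rfl⟩
  have hlen : (a :: (m₁ ++ b :: m₂)).length = m + 1 := by rw [← hL]; simp
  refine ⟨m₁, m₂, l, hL ▸ hnd, hlen, ?_, fun w => ?_⟩
  · rw [hsl]
    congr 1
    rw [hsl] at hlast
    have hlen' := congrArg List.length hlast
    simp only [List.length_map, List.length_range, List.length_cons, List.length_append] at hlen'
    -- These two positions of the closed walk hold `b` and the entry after it, which identifies `s`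
    -- as the successor of `b`.
    have h1 := congrArg (fun L => L[m₁.length + 1]?) hlast
    have h2 := congrArg (fun L => L[m₁.length + 2]?) hlast
    have e1 : m₁.length + 1 < m + 2 := by omega
    have e2 : m₁.length + 2 < m + 2 := by omega
    simp [e1, e2] at h1 h2
    rw [← h1, ← h2]
    simp only [hg, finRotate_apply, Equiv.symm_apply_apply]
    congr 1
    push_cast
    ring
  · rw [sum_perm_finRotate_eq_walkWeight w σ c, ← hlast]

end Walks

/-! ### Moving one node -/

/-- Quantitative subadditivity. For `x ≤ y` and `t = x / y ≤ 1`, Bernoulli gives `(1 + t)^α ≤ 1 + α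
t ≤ 1 + α t^α`. Multiplying by `y^α` leaves `(1 - α) x^α` to spare. -/
lemma add_rpow_add_le {α ρ x y : ℝ} (hα₀ : 0 < α) (hα₁ : α < 1) (hρ : 0 < ρ) (hx : ρ ≤ x)
    (hy : ρ ≤ y) : (x + y) ^ α + (1 - α) * ρ ^ α ≤ x ^ α + y ^ α := by
  wlog hxy : x ≤ y generalizing x y
  · rw [add_comm x, add_comm (x ^ α)]
    exact this hy hx (le_of_not_ge hxy)
  have hx0 : 0 < x := hρ.trans_le hx
  have hy0 : 0 < y := hρ.trans_le hy
  have ht1 : x / y ≤ 1 := (div_le_one hy0).2 hxy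
  have ht0 : 0 < x / y := div_pos hx0 hy0
  have hb : (1 + x / y) ^ α ≤ 1 + α * (x / y) :=
    rpow_one_add_le_one_add_mul_self (by linarith) hα₀.le hα₁.le
  have hpow : x / y ≤ (x / y) ^ α := by
    conv_lhs => rw [← Real.rpow_one (x / y)]
    exact Real.rpow_le_rpow_of_exponent_ge ht0 ht1 hα₁.le
  have e1 : (x + y) ^ α = y ^ α * (1 + x / y) ^ α := by
    rw [← Real.mul_rpow hy0.le (by positivity)]
    congr 1
    field_simp
    ring_nf
  have e2 : y ^ α * (x / y) ^ α = x ^ α := by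
    rw [← Real.mul_rpow hy0.le ht0.le]
    congr 1
    field_simp
  have hyα : 0 < y ^ α := Real.rpow_pos_of_pos hy0 _
  have hxρ : ρ ^ α ≤ x ^ α := Real.rpow_le_rpow hρ.le hx hα₀.le
  calc (x + y) ^ α + (1 - α) * ρ ^ α
      ≤ y ^ α * (1 + α * (x / y) ^ α) + (1 - α) * x ^ α := by
        rw [e1]
        have : (1 + x / y) ^ α ≤ 1 + α * (x / y) ^ α :=
          hb.trans (by gcongr)
        have h1 : 0 ≤ 1 - α := by linarith
        gcongr
    _ = x ^ α + y ^ α := by rw [mul_add, mul_left_comm, e2]; ring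

lemma dist_rpow_le_add {M : Type*} [PseudoMetricSpace M] {α : ℝ} (hα₀ : 0 < α) (hα₁ : α < 1)
    (x y z : M) : dist x z ^ α ≤ dist x y ^ α + dist y z ^ α :=
  (Real.rpow_le_rpow dist_nonneg (dist_triangle x y z) hα₀.le).trans
    (Real.rpow_add_le_add_rpow dist_nonneg dist_nonneg hα₀.le hα₁.le)

lemma exists_tspWeight_eq (h : Plane → Plane → ℝ) (α : ℝ) {n : ℕ} (x : Fin n → Plane) :
    ∃ σ, tspWeight h α x = cycleWeight h α x σ := by
  obtain ⟨σ, -, hσ⟩ := Finset.exists_mem_eq_inf' Finset.univ_nonempty (cycleWeight h α x)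
  exact ⟨σ, hσ⟩

/-- Moving a node by the distance `δ` raises the minimum weight by at most `2 δ ^ α`. -/
lemma tspWeight_update_le {S S₀ : Set Plane} {h : Plane → Plane → ℝ}
    (hS₀ : ∀ u ∈ S, ∀ v ∈ S, u ∈ S₀ ∨ v ∈ S₀ → h u v = dist u v)
    {α : ℝ} (hα₀ : 0 < α) (hα₁ : α < 1) {n : ℕ} {x : Fin n → Plane} (hx : ∀ i, x i ∈ S)
    {b : Fin n} {v : Plane} (hv : v ∈ S) (hb₀ : x b ∈ S₀) (hv₀ : v ∈ S₀) :
    tspWeight h α (Function.update x b v) ≤ tspWeight h α x + 2 * dist (x b) v ^ α := by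
  obtain ⟨σ, hσ⟩ := exists_tspWeight_eq h α x
  have hd : 0 ≤ dist (x b) v ^ α := Real.rpow_nonneg dist_nonneg _
  have hle : tspWeight h α (Function.update x b v) ≤
      cycleWeight h α (Function.update x b v) σ := Finset.inf'_le _ (Finset.mem_univ σ)
  refine hle.trans ?_
  -- The cycle is kept. Only edges at `b` change, and these are Euclidean before and after the move,
  -- so each endpoint equal to `b` costs at most `dist (x b) v ^ α`.
  have key : ∀ i j : Fin n, h (Function.update x b v i) (Function.update x b v j) ^ α ≤
      h (x i) (x j) ^ α + ((if i = b then dist (x b) v ^ α else 0) +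
        (if j = b then dist (x b) v ^ α else 0)) := by
    intro i j
    by_cases hi : i = b <;> by_cases hj : j = b
    · subst hi hj
      simp only [Function.update_self, if_true]
      rw [hS₀ v hv v hv (Or.inl hv₀), hS₀ _ (hx _) _ (hx _) (Or.inl hb₀), dist_self, dist_self]
      linarith
    · subst hi
      simp only [Function.update_self, Function.update_of_ne hj, if_true, if_neg hj]
      rw [hS₀ v hv _ (hx j) (Or.inl hv₀), hS₀ _ (hx _) _ (hx _) (Or.inl hb₀), dist_comm (x i) v]
      linarith [dist_rpow_le_add hα₀ hα₁ v (x i) (x j)]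
    · subst hj
      simp only [Function.update_self, Function.update_of_ne hi, if_true, if_neg hi]
      rw [hS₀ _ (hx i) v hv (Or.inr hv₀), hS₀ _ (hx _) _ (hx _) (Or.inr hb₀)]
      linarith [dist_rpow_le_add hα₀ hα₁ (x i) (x j) v]
    · simp [hi, hj]
  calc cycleWeight h α (Function.update x b v) σ
      ≤ ∑ k, (h (x (σ k)) (x (σ (finRotate n k))) ^ α +
          ((if σ k = b then dist (x b) v ^ α else 0) +
            (if σ (finRotate n k) = b then dist (x b) v ^ α else 0))) :=
        Finset.sum_le_sum fun k _ => key _ _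
    _ = tspWeight h α x + 2 * dist (x b) v ^ α := by
        rw [Finset.sum_add_distrib, Finset.sum_add_distrib, hσ, cycleWeight,
          Equiv.sum_comp (finRotate n) (fun k => if σ k = b then dist (x b) v ^ α else 0),
          Equiv.sum_comp σ (fun k => if k = b then dist (x b) v ^ α else 0)]
        simp
        ring

/-- Taking a node that is at a distance at least `ρ` from all the others out of an optimal cycle
and putting it back at `v`, next to the node `a`. -/
lemma tspWeight_update_le_of_isolated {S S₀ : Set Plane} {h : Plane → Plane → ℝ}
    (hS₀ : ∀ u ∈ S, ∀ v ∈ S, u ∈ S₀ ∨ v ∈ S₀ → h u v = dist u v)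
    {α : ℝ} (hα₀ : 0 < α) (hα₁ : α < 1) {n : ℕ} {x : Fin n → Plane} (hx : ∀ i, x i ∈ S)
    {a b : Fin n} (hab : a ≠ b) {v : Plane} (hv : v ∈ S) (ha₀ : x a ∈ S₀) (hb₀ : x b ∈ S₀)
    (hv₀ : v ∈ S₀) {ρ : ℝ} (hρ : 0 < ρ) (hiso : ∀ i, i ≠ b → ρ ≤ dist (x b) (x i))
    {σ : Equiv.Perm (Fin n)} (hσ : tspWeight h α x = cycleWeight h α x σ)
    (hnext : x (σ (finRotate n (σ.symm b))) ∈ S₀) :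
    tspWeight h α (Function.update x b v) ≤
      tspWeight h α x - (1 - α) * ρ ^ α + 2 * dist v (x a) ^ α := by
  set x' := Function.update x b v with hx'
  set w : Fin n → Fin n → ℝ := fun i j => h (x i) (x j) ^ α with hw
  set w' : Fin n → Fin n → ℝ := fun i j => h (x' i) (x' j) ^ α with hw'
  obtain ⟨m₁, m₂, l, hnd, hlen, hl, hsum⟩ := exists_split_cycle σ hab
  set s := σ (finRotate n (σ.symm b)) with hs
  obtain ⟨p, P, hP⟩ : ∃ (p : Fin n) (P : List (Fin n)), a :: m₁ = P ++ [p] := by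
    have hne : a :: m₁ ≠ [] := by simp
    exact ⟨_, _, (List.dropLast_append_getLast hne).symm⟩
  -- `z` is the node after `a` once `b` is removed; it is `s` when `b` directly follows `a`.
  obtain ⟨z, Z, hZ⟩ : ∃ z Z, m₁ ++ (m₂ ++ [a]) = z :: Z := by
    cases m₁ with
    | nil => exact ⟨s, l, by simpa using hl⟩
    | cons z Z => exact ⟨z, Z ++ (m₂ ++ [a]), rfl⟩
  have hb_not : b ∉ a :: (m₁ ++ m₂) := by
    simp only [List.nodup_cons, List.mem_append, List.mem_cons, List.nodup_append] at hnd ⊢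
    grind
  have hT : tspWeight h α x =
      walkWeight w (P ++ [p]) + w p b + w b s + walkWeight w (s :: l) := by
    rw [hσ, cycleWeight, hsum w, ← List.cons_append, hP, List.append_assoc, hl]
    simp only [List.singleton_append]
    rw [walkWeight_append_cons_cons, walkWeight]
    ring
  have hperm : (a :: (b :: (m₁ ++ m₂))).Perm (a :: (m₁ ++ b :: m₂)) :=
    (List.perm_middle.symm).cons a
  have hT' : tspWeight h α x' ≤ w' a b + w' b z + walkWeight w' (z :: Z) := by
    have := tspWeight_le_walkWeight h α x' a (b :: (m₁ ++ m₂)) (hperm.nodup_iff.2 hnd)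
      (hperm.length_eq.trans hlen)
    rwa [List.cons_append, List.append_assoc, hZ, walkWeight, walkWeight, ← add_assoc] at this
  have hmem : ∀ i ∈ z :: Z, i ≠ b := by
    intro i hi hib
    rw [← hZ, hib] at hi
    apply hb_not
    simp only [List.mem_append, List.mem_cons, List.not_mem_nil, or_false] at hi ⊢
    tauto
  have hww' : walkWeight w' (z :: Z) = walkWeight w (z :: Z) := by
    refine walkWeight_congr fun i hi j hj => ?_
    simp only [hw, hw', hx', Function.update_of_ne (hmem i hi), Function.update_of_ne (hmem j hj)]
  -- The cycle without `b`, split once at the edge `a z`, where `b` is reinserted, and once at the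
  -- edge `p s` that bypasses its old place.
  have hclosed : w a z + walkWeight w (z :: Z) =
      walkWeight w (P ++ [p]) + w p s + walkWeight w (s :: l) := by
    have : a :: z :: Z = P ++ p :: s :: l := by
      rw [← hZ, ← List.cons_append, hP, hl]; simp
    rw [← walkWeight_append_cons_cons, ← this, walkWeight]
  have hzb : z ≠ b := hmem z (by simp)
  have hpb : p ≠ b := by
    intro hpb
    apply hb_not
    have : p ∈ a :: m₁ := by rw [hP]; simp
    rw [hpb] at this
    simp only [List.mem_append, List.mem_cons] at this ⊢
    tauto
  have hsb : s ≠ b := by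
    intro hsb
    apply hb_not
    have : s ∈ m₂ ++ [a] := by rw [hl]; simp
    rw [hsb] at this
    simp only [List.mem_append, List.mem_cons, List.not_mem_nil, or_false] at this ⊢
    tauto
  have e1 : w' a b = dist v (x a) ^ α := by
    simp only [hw', hx', Function.update_self, Function.update_of_ne hab]
    rw [hS₀ _ (hx a) v hv (Or.inr hv₀), dist_comm]
  have e2 : w' b z ≤ dist v (x a) ^ α + w a z := by
    simp only [hw', hw, hx', Function.update_self, Function.update_of_ne hzb]
    rw [hS₀ v hv _ (hx z) (Or.inl hv₀), hS₀ _ (hx a) _ (hx z) (Or.inl ha₀)]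
    exact dist_rpow_le_add hα₀ hα₁ _ _ _
  -- The only use of `hnext`: the bypass `p s` has Euclidean weight because `s` lies in `S₀`.
  have e3 : w p s + (1 - α) * ρ ^ α ≤ w p b + w b s := by
    simp only [hw]
    rw [hS₀ _ (hx p) _ (hx s) (Or.inr hnext), hS₀ _ (hx p) _ (hx b) (Or.inr hb₀),
      hS₀ _ (hx b) _ (hx s) (Or.inl hb₀)]
    have h1 : dist (x p) (x s) ^ α ≤ (dist (x p) (x b) + dist (x b) (x s)) ^ α :=
      Real.rpow_le_rpow dist_nonneg (dist_triangle _ _ _) hα₀.le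
    have h2 := add_rpow_add_le hα₀ hα₁ hρ (x := dist (x p) (x b)) (y := dist (x b) (x s))
      (by rw [dist_comm]; exact hiso p hpb) (hiso s hsb)
    linarith
  rw [hww'] at hT'
  linarith

/-! ### Upper bounds -/

lemma isBounded_unitSquare : Bornology.IsBounded unitSquare := by
  refine (Metric.isBounded_iff_subset_closedBall 0).2 ⟨1, fun x hx => ?_⟩
  rw [mem_closedBall_zero_iff, EuclideanSpace.norm_eq, Real.sqrt_le_one]
  have h0 := hx 0
  have h1 := hx 1
  simp only [Set.mem_Icc] at h0 h1
  simp only [Fin.sum_univ_two, Real.norm_eq_abs, sq_abs]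
  nlinarith

lemma exists_finite_index {M : Type*} [PseudoMetricSpace M] {S : Set M} (hS : TotallyBounded S)
    {t : ℝ} (ht : 0 < t) :
    ∃ (m : ℕ) (c : M → Fin (m + 1)), ∀ x ∈ S, ∀ y ∈ S, c x = c y → dist x y ≤ t := by
  obtain ⟨Z, hZ, hcov⟩ := Metric.totallyBounded_iff.1 hS (t / 2) (by positivity)
  have hex : ∀ x ∈ S, ∃ z ∈ Z, dist x z < t / 2 := by
    intro x hx
    simpa using hcov hx
  classical
  have : Finite Z := hZ
  obtain ⟨m, ⟨e⟩⟩ := Finite.exists_equiv_fin Z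
  refine ⟨m, fun x => if hx : x ∈ S then
    (e ⟨(hex x hx).choose, (hex x hx).choose_spec.1⟩).castSucc else 0, fun x hx y hy hxy => ?_⟩
  simp only [dif_pos hx, dif_pos hy] at hxy
  have h1 := congrArg Subtype.val (e.injective (Fin.castSucc_injective _ hxy))
  simp only at h1
  have h2 := (hex x hx).choose_spec.2
  have h3 := (hex y hy).choose_spec.2
  rw [← h1] at h3
  linarith [dist_triangle_right x y (hex x hx).choose]

/-- The minimum weight through `n` nodes of a bounded set is `o(n)`, uniformly in the nodes. -/
lemma exists_tspWeight_le {S : Set Plane} (hS : Bornology.IsBounded S) {h : Plane → Plane → ℝ}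
    {c₂ : ℝ} (hc₂ : 0 < c₂)
    (hh : ∀ x ∈ S, ∀ y ∈ S, 0 ≤ h x y ∧ h x y ≤ c₂ * dist x y) {α : ℝ} (hα₀ : 0 < α)
    {η : ℝ} (hη : 0 < η) :
    ∃ C : ℝ, 0 ≤ C ∧ ∀ (n : ℕ) (x : Fin n → Plane), (∀ i, x i ∈ S) →
      tspWeight h α x ≤ η * n + C := by
  -- The diameter of the classes is chosen so that an edge inside a class weighs at most `(c₂ t)^α =
  -- η`. The nodes are then visited class by class.
  set t : ℝ := η ^ α⁻¹ / c₂ with ht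
  have ht0 : 0 < t := div_pos (Real.rpow_pos_of_pos hη _) hc₂
  have htη : (c₂ * t) ^ α = η := by
    rw [ht, mul_div_cancel₀ _ hc₂.ne', Real.rpow_inv_rpow hη.le hα₀.ne']
  obtain ⟨m, c, hc⟩ := exists_finite_index
    (hS.isCompact_closure.totallyBounded.subset subset_closure) ht0
  obtain ⟨R, hR⟩ := Metric.isBounded_iff.1 hS
  set D : ℝ := (c₂ * max R 0) ^ α with hD
  have hD0 : 0 ≤ D := Real.rpow_nonneg (by positivity) _
  refine ⟨D * (m + 1), by positivity, fun n x hx => ?_⟩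
  obtain _ | k := n
  · simp only [tspWeight, cycleWeight, Finset.univ_eq_empty, Finset.sum_empty]
    simp
    positivity
  set f : Fin (k + 1) → Fin (m + 1) := fun i => c (x i) with hf
  set σ := Tuple.sort f with hσ
  have hmono : Monotone (f ∘ σ) := Tuple.monotone_sort f
  have hle : tspWeight h α x ≤ cycleWeight h α x σ := Finset.inf'_le _ (Finset.mem_univ σ)
  refine hle.trans ?_
  have hD_le : ∀ i j, h (x i) (x j) ^ α ≤ D := fun i j =>
    Real.rpow_le_rpow (hh _ (hx i) _ (hx j)).1 ((hh _ (hx i) _ (hx j)).2.trans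
      (mul_le_mul_of_nonneg_left ((hR (hx i) (hx j)).trans (le_max_left _ _)) hc₂.le)) hα₀.le
  set F : Fin (k + 1) → ℝ := fun i => ((f (σ i) : ℕ) : ℝ) with hF
  -- A change of class is charged to the increase of the class index `F`. The increments of `F` sum
  -- to zero around the cycle; the closing edge, where `F` may drop by as much as `m`, is
  -- compensated by the extra `D * (m + 1)`.
  have hkey : ∀ i : Fin (k + 1), h (x (σ i)) (x (σ (finRotate (k + 1) i))) ^ α ≤
      η + D * (F (finRotate (k + 1) i) - F i) + if i = Fin.last k then D * (m + 1) else 0 := by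
    intro i
    by_cases hi : i = Fin.last k
    · rw [if_pos hi]
      have h1 : F i ≤ m := by
        simp only [hF]; exact_mod_cast Nat.lt_succ_iff.1 (f (σ i)).isLt
      have h2 : 0 ≤ F (finRotate (k + 1) i) := Nat.cast_nonneg _
      have h3 := hD_le (σ i) (σ (finRotate (k + 1) i))
      nlinarith [mul_nonneg hD0 h2, mul_nonneg hD0 (sub_nonneg.2 h1)]
    · rw [if_neg hi, add_zero]
      have hlt : i ≤ finRotate (k + 1) i := by
        rw [finRotate_apply]
        exact (Fin.lt_add_one_iff.2 (lt_of_le_of_ne (Fin.le_last i) hi)).le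
      have hle := hmono hlt
      rcases hle.eq_or_lt with he | hl
      · have hFe : F (finRotate (k + 1) i) = F i := by
          simp only [hF]; simp only [Function.comp] at he; rw [he]
        rw [hFe, sub_self, mul_zero, add_zero, ← htη]
        refine Real.rpow_le_rpow (hh _ (hx _) _ (hx _)).1 ((hh _ (hx _) _ (hx _)).2.trans ?_) hα₀.le
        exact mul_le_mul_of_nonneg_left (hc _ (hx _) _ (hx _) he) hc₂.le
      · have hF1 : F i + 1 ≤ F (finRotate (k + 1) i) := by
          simp only [hF]; exact_mod_cast hl
        have h3 := hD_le (σ i) (σ (finRotate (k + 1) i))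
        nlinarith [mul_nonneg hD0 (by linarith : 0 ≤ F (finRotate (k + 1) i) - F i - 1)]
  calc cycleWeight h α x σ ≤ _ := Finset.sum_le_sum fun i _ => hkey i
    _ = η * (k + 1 : ℕ) + D * (m + 1) := by
      rw [Finset.sum_add_distrib, Finset.sum_add_distrib, ← Finset.mul_sum,
        Finset.sum_sub_distrib, Equiv.sum_comp (finRotate (k + 1)) F]
      simp
      ring

/-- Few nodes of a cycle have a successor at a large distance. -/
lemma card_mul_le_cycleWeight {S : Set Plane} {h : Plane → Plane → ℝ}
    (hh : ∀ x ∈ S, ∀ y ∈ S, 0 ≤ h x y) {α : ℝ} {n : ℕ} {x : Fin n → Plane} (hx : ∀ i, x i ∈ S)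
    (σ : Equiv.Perm (Fin n)) {d : ℝ} (B : Finset (Fin n))
    (hB : ∀ b ∈ B, d ≤ h (x b) (x (σ (finRotate n (σ.symm b)))) ^ α) :
    B.card * d ≤ cycleWeight h α x σ := by
  have e : cycleWeight h α x σ =
      ∑ b, h (x b) (x (σ (finRotate n (σ.symm b)))) ^ α := by
    rw [cycleWeight, ← Equiv.sum_comp σ
      (fun b => h (x b) (x (σ (finRotate n (σ.symm b)))) ^ α)]
    simp only [Equiv.symm_apply_apply]
  rw [e, ← nsmul_eq_mul]
  calc B.card • d ≤ ∑ b ∈ B, h (x b) (x (σ (finRotate n (σ.symm b)))) ^ α :=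
        Finset.card_nsmul_le_sum _ _ _ hB
    _ ≤ _ := Finset.sum_le_sum_of_subset_of_nonneg (Finset.subset_univ _)
        fun b _ _ => Real.rpow_nonneg (hh _ (hx _) _ (hx _)) _

/-! ### A test function that is correlated with the weight -/

section Correlation

variable {V : Type*}

/-- The product over the coordinates of the indicator of `A` at `a`, of `g` at `b`, and of the
indicator of the complement of `Q` everywhere else. -/
noncomputable def pairFactor (A Q : Set V) (g : V → ℝ) {n : ℕ} (a b l : Fin n) : V → ℝ :=
  if l = a then A.indicator 1 else if l = b then g else Qᶜ.indicator 1

/-- The product of the `pairFactor`s. -/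
noncomputable def pairProd (A Q : Set V) (g : V → ℝ) {n : ℕ} (a b : Fin n) (x : Fin n → V) : ℝ :=
  ∏ l, pairFactor A Q g a b l (x l)

lemma abs_indicator_one_le (B : Set V) (u : V) : |B.indicator (1 : V → ℝ) u| ≤ 1 := by
  by_cases hu : u ∈ B <;> simp [hu]

lemma abs_pairProd_le {A Q : Set V} {g : V → ℝ} (hg : ∀ u, |g u| ≤ 1) {n : ℕ} (a b : Fin n)
    (x : Fin n → V) : |pairProd A Q g a b x| ≤ 1 := by
  rw [pairProd, Finset.abs_prod]
  refine Finset.prod_le_one (fun _ _ => abs_nonneg _) fun l _ => ?_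
  unfold pairFactor
  split_ifs
  · exact abs_indicator_one_le _ _
  · exact hg _
  · exact abs_indicator_one_le _ _

lemma prod_ite_ite {n : ℕ} {a b : Fin n} (hab : a ≠ b) (p q r : ℝ) :
    ∏ l : Fin n, (if l = a then p else if l = b then q else r) = p * q * r ^ (n - 2) := by
  rw [← Finset.mul_prod_erase Finset.univ _ (Finset.mem_univ a),
    ← Finset.mul_prod_erase (Finset.univ.erase a) _
      (Finset.mem_erase.2 ⟨hab.symm, Finset.mem_univ b⟩), if_pos rfl, if_neg hab.symm, if_pos rfl,
    Finset.prod_congr rfl (g := fun _ => r), Finset.prod_const, Finset.card_erase_of_mem,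
    Finset.card_erase_of_mem, Finset.card_univ, Fintype.card_fin, Nat.sub_sub, mul_assoc]
  · exact Finset.mem_univ a
  · exact Finset.mem_erase.2 ⟨hab.symm, Finset.mem_univ b⟩
  · intro l hl
    simp only [Finset.mem_erase] at hl
    rw [if_neg hl.2.1, if_neg hl.1]

lemma pairProd_indicator {A B Q : Set V} {n : ℕ} {a b : Fin n} (hab : a ≠ b) (x : Fin n → V)
    [Decidable (x a ∈ A ∧ x b ∈ B ∧ ∀ l, l ≠ a → l ≠ b → x l ∉ Q)] :
    pairProd A Q (B.indicator 1) a b x =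
      if x a ∈ A ∧ x b ∈ B ∧ ∀ l, l ≠ a → l ≠ b → x l ∉ Q then 1 else 0 := by
  unfold pairProd pairFactor
  split_ifs with hE
  · refine Finset.prod_eq_one fun l _ => ?_
    by_cases hla : l = a
    · subst hla; simp [hE.1]
    · by_cases hlb : l = b
      · subst hlb; simp [hla, hE.2.1]
      · simp [hla, hlb, hE.2.2 l hla hlb]
  · rw [Finset.prod_eq_zero_iff]
    by_contra hcon
    push Not at hcon
    refine hE ⟨?_, ?_, fun l hla hlb hl => ?_⟩
    · have := hcon a (Finset.mem_univ a)
      by_contra hne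
      simp [hne] at this
    · have := hcon b (Finset.mem_univ b)
      by_contra hne
      simp [hne, hab.symm] at this
    · have := hcon l (Finset.mem_univ l)
      simp [hla, hlb, hl] at this

variable [MeasurableSpace V]

/-- The combination of the indicators of `B` and `B'` that has integral zero. -/
noncomputable def contrast (μ : Measure V) (B B' : Set V) (u : V) : ℝ :=
  μ.real B' * B.indicator 1 u - μ.real B * B'.indicator 1 u

lemma measurable_contrast {μ : Measure V} {B B' : Set V} (hB : MeasurableSet B)
    (hB' : MeasurableSet B') : Measurable (contrast μ B B') :=
  ((measurable_one.indicator hB).const_mul _).sub ((measurable_one.indicator hB').const_mul _)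

lemma integrable_indicator_one (μ : Measure V) [IsFiniteMeasure μ] {B : Set V}
    (hB : MeasurableSet B) : Integrable (B.indicator (1 : V → ℝ)) μ :=
  (integrable_const (1 : ℝ)).indicator hB

lemma integral_contrast (μ : Measure V) [IsFiniteMeasure μ] {B B' : Set V} (hB : MeasurableSet B)
    (hB' : MeasurableSet B') : ∫ u, contrast μ B B' u ∂μ = 0 := by
  simp only [contrast]
  rw [integral_sub ((integrable_indicator_one μ hB).const_mul _)
    ((integrable_indicator_one μ hB').const_mul _), integral_const_mul, integral_const_mul,
    integral_indicator_one hB, integral_indicator_one hB']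
  ring

lemma abs_contrast_le (μ : Measure V) [IsProbabilityMeasure μ] {B B' : Set V}
    (hBB' : Disjoint B B') (u : V) : |contrast μ B B' u| ≤ 1 := by
  have h1 : μ.real B ≤ 1 := measureReal_le_one
  have h2 : μ.real B' ≤ 1 := measureReal_le_one
  have h3 : 0 ≤ μ.real B := measureReal_nonneg
  have h4 : 0 ≤ μ.real B' := measureReal_nonneg
  by_cases hu : u ∈ B
  · have hu' : u ∉ B' := fun h => hBB'.le_bot ⟨hu, h⟩
    simp [contrast, hu, hu', abs_of_nonneg, h2]
  · by_cases hu' : u ∈ B' <;> simp [contrast, hu, hu', abs_of_nonneg, h1]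

lemma integral_contrast_mul (μ : Measure V) [IsFiniteMeasure μ] {B B' : Set V}
    (hB : MeasurableSet B) (hB' : MeasurableSet B') {F : V → ℝ} (hF : Integrable F μ) :
    ∫ u, contrast μ B B' u * F u ∂μ =
      μ.real B' * ∫ u in B, F u ∂μ - μ.real B * ∫ u in B', F u ∂μ := by
  have e : ∀ u, contrast μ B B' u * F u =
      μ.real B' * B.indicator F u - μ.real B * B'.indicator F u := by
    intro u
    by_cases hu : u ∈ B <;> by_cases hu' : u ∈ B' <;> (simp [contrast, hu, hu']; try ring)
  simp only [e]
  rw [integral_sub ((hF.indicator hB).const_mul _) ((hF.indicator hB').const_mul _),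
    integral_const_mul, integral_const_mul, integral_indicator hB, integral_indicator hB']

lemma integral_contrast_sq_le (μ : Measure V) [IsProbabilityMeasure μ] {B B' : Set V}
    (hB : MeasurableSet B) (hB' : MeasurableSet B') (hBB' : Disjoint B B') {M : ℝ}
    (h1 : μ.real B ≤ M) (h2 : μ.real B' ≤ M) :
    ∫ u, contrast μ B B' u * contrast μ B B' u ∂μ ≤ 2 * M ^ 3 := by
  have e : ∀ u, contrast μ B B' u * contrast μ B B' u =
      μ.real B' ^ 2 * B.indicator 1 u + μ.real B ^ 2 * B'.indicator 1 u := by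
    intro u
    by_cases hu : u ∈ B
    · have hu' : u ∉ B' := fun h => hBB'.le_bot ⟨hu, h⟩
      simp [contrast, hu, hu']; ring
    · by_cases hu' : u ∈ B'
      · simp [contrast, hu, hu']; ring
      · simp [contrast, hu, hu']
  simp only [e]
  rw [integral_add ((integrable_indicator_one μ hB).const_mul _)
    ((integrable_indicator_one μ hB').const_mul _), integral_const_mul, integral_const_mul,
    integral_indicator_one hB, integral_indicator_one hB']
  have h3 : 0 ≤ μ.real B := measureReal_nonneg
  have h4 : 0 ≤ μ.real B' := measureReal_nonneg
  have h5 : μ.real B' ^ 2 ≤ M ^ 2 := by gcongr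
  have h6 : μ.real B ^ 2 ≤ M ^ 2 := by gcongr
  have hM : 0 ≤ M := h3.trans h1
  nlinarith [mul_le_mul h5 h1 h3 (sq_nonneg M), mul_le_mul h6 h2 h4 (sq_nonneg M)]

lemma measurable_pairFactor {A Q : Set V} {g : V → ℝ} (hA : MeasurableSet A)
    (hQ : MeasurableSet Q) (hg : Measurable g) {n : ℕ} (a b l : Fin n) :
    Measurable (pairFactor A Q g a b l) := by
  unfold pairFactor
  split_ifs
  · exact measurable_one.indicator hA
  · exact hg
  · exact measurable_one.indicator hQ.compl

lemma measurable_pairProd {A Q : Set V} {g : V → ℝ} (hA : MeasurableSet A)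
    (hQ : MeasurableSet Q) (hg : Measurable g) {n : ℕ} (a b : Fin n) :
    Measurable (pairProd A Q g a b) :=
  Finset.measurable_prod _ fun l _ =>
    (measurable_pairFactor hA hQ hg a b l).comp (measurable_pi_apply l)

variable (μ : Measure V) [IsProbabilityMeasure μ]

lemma integral_pairProd {A Q : Set V} {g : V → ℝ} (hA : MeasurableSet A) (hQ : MeasurableSet Q)
    {n : ℕ} {a b : Fin n} (hab : a ≠ b) :
    ∫ x, pairProd A Q g a b x ∂(Measure.pi fun _ : Fin n => μ) =
      μ.real A * (∫ u, g u ∂μ) * (1 - μ.real Q) ^ (n - 2) := by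
  simp only [pairProd]
  rw [integral_fintype_prod_eq_prod (fun l => pairFactor A Q g a b l), ← prod_ite_ite hab]
  refine Finset.prod_congr rfl fun l _ => ?_
  unfold pairFactor
  split_ifs
  · exact integral_indicator_one hA
  · rfl
  · rw [integral_indicator_one hQ.compl, probReal_compl_eq_one_sub hQ]

lemma integral_pairProd_mul_self_le {A Q : Set V} {g : V → ℝ} (hA : MeasurableSet A)
    (hQ : MeasurableSet Q) {n : ℕ} {a b : Fin n} (hab : a ≠ b) :
    ∫ x, pairProd A Q g a b x * pairProd A Q g a b x ∂(Measure.pi fun _ : Fin n => μ) ≤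
      μ.real A * ∫ u, g u * g u ∂μ := by
  have e : ∀ x : Fin n → V, pairProd A Q g a b x * pairProd A Q g a b x =
      pairProd A Q (fun u => g u * g u) a b x := by
    intro x
    simp only [pairProd, ← Finset.prod_mul_distrib]
    refine Finset.prod_congr rfl fun l _ => ?_
    unfold pairFactor
    split_ifs
    · by_cases hx : x l ∈ A <;> simp [hx]
    · rfl
    · by_cases hx : x l ∈ Q <;> simp [hx]
  simp only [e]
  rw [integral_pairProd μ hA hQ hab]
  have h1 : 0 ≤ μ.real Q := measureReal_nonneg
  have h2 : μ.real Q ≤ 1 := measureReal_le_one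
  exact mul_le_of_le_one_right
    (mul_nonneg measureReal_nonneg (integral_nonneg fun u => mul_self_nonneg _))
    (pow_le_one₀ (by linarith) (by linarith))

/-- By Bernoulli the other nodes all avoid `Q` with probability at least `1 - n μ(Q) ≥ 1 / 2`. -/
lemma half_mul_le_integral_pairProd {A B Q : Set V} (hA : MeasurableSet A) (hB : MeasurableSet B)
    (hQ : MeasurableSet Q) {n : ℕ} (hn : n * μ.real Q ≤ 1 / 2) {a b : Fin n} (hab : a ≠ b) :
    μ.real A * μ.real B / 2 ≤
      ∫ x, pairProd A Q (B.indicator 1) a b x ∂(Measure.pi fun _ : Fin n => μ) := by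
  rw [integral_pairProd μ hA hQ hab, integral_indicator_one hB]
  have h1 : 0 ≤ μ.real Q := measureReal_nonneg
  have h2 : μ.real Q ≤ 1 := measureReal_le_one
  have h3 : (1 - μ.real Q) ^ n ≤ (1 - μ.real Q) ^ (n - 2) :=
    pow_le_pow_of_le_one (by linarith) (by linarith) (Nat.sub_le _ _)
  have h4 := one_add_mul_le_pow (a := -μ.real Q) (by linarith) n
  rw [← sub_eq_add_neg 1 (μ.real Q)] at h4
  rw [div_eq_mul_inv]
  refine mul_le_mul_of_nonneg_left ?_ (mul_nonneg measureReal_nonneg measureReal_nonneg)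
  linarith

/-- Products of two test functions that belong to different pairs of nodes, or to different
cells, have integral zero. -/
lemma integral_pairProd_mul_eq_zero {A Q A' Q' : Set V} {g g' : V → ℝ} (hAQ : A ⊆ Q)
    (hAQ' : A' ⊆ Q') (hg : ∀ u ∉ Q, g u = 0) (hg' : ∀ u ∉ Q', g' u = 0)
    (hgA : ∀ u ∈ A, g u = 0) (hint : ∫ u, g u ∂μ = 0)
    {n : ℕ} {a b a' b' : Fin n} (hab : a ≠ b) (hab' : a' ≠ b')
    (hne : Disjoint Q Q' ∨ (A = A' ∧ Q = Q' ∧ (a, b) ≠ (a', b'))) :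
    ∫ x, pairProd A Q g a b x * pairProd A' Q' g' a' b' x
      ∂(Measure.pi fun _ : Fin n => μ) = 0 := by
  simp only [pairProd, ← Finset.prod_mul_distrib]
  rw [integral_fintype_prod_eq_prod
    (fun l u => pairFactor A Q g a b l u * pairFactor A' Q' g' a' b' l u)]
  rcases hne with hdis | ⟨rfl, rfl, hne⟩
  -- Disjoint cells: at coordinate `b` the second factor either is supported in `Q'`, where `g`
  -- vanishes, or equals `1` on `Q`, which leaves `∫ g = 0`.
  · refine Finset.prod_eq_zero (Finset.mem_univ b) ?_
    have hnot : ∀ u ∈ Q, u ∉ Q' := fun u h1 h2 => hdis.le_bot ⟨h1, h2⟩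
    have hzero : ∀ k : V → ℝ, (∀ u ∉ Q', k u = 0) → ∀ u, g u * k u = 0 := by
      intro k hk u
      by_cases hu : u ∈ Q
      · rw [hk u (hnot u hu), mul_zero]
      · rw [hg u hu, zero_mul]
    have e : pairFactor A Q g a b b = g := by simp [pairFactor, hab.symm]
    rw [e]
    unfold pairFactor
    split_ifs
    · simp only [hzero (A'.indicator 1) fun u hu =>
        Set.indicator_of_notMem (fun h => hu (hAQ' h)) _, integral_zero]
    · simp only [hzero g' hg', integral_zero]
    · rw [← hint]
      congr 1
      ext u
      by_cases hu : u ∈ Q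
      · simp [hnot u hu]
      · rw [hg u hu, zero_mul]
  -- Same cell: one function requires a node in `Q` that the other excludes from `Q`, or a node in
  -- `A`, where `g` vanishes.
  · by_cases hb : b = b'
    · subst hb
      have ha : a ≠ a' := fun h => hne (by rw [h])
      refine Finset.prod_eq_zero (Finset.mem_univ a) ?_
      simp only [pairFactor, if_true, if_neg ha, if_neg hab]
      refine integral_eq_zero_of_ae (ae_of_all _ fun u => ?_)
      simp only [Pi.zero_apply]
      by_cases hu : u ∈ A
      · simp [hAQ hu]
      · simp [hu]
    · refine Finset.prod_eq_zero (Finset.mem_univ b) ?_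
      simp only [pairFactor, if_true, if_neg hab.symm, if_neg hb]
      refine integral_eq_zero_of_ae (ae_of_all _ fun u => ?_)
      simp only [Pi.zero_apply]
      split_ifs
      · by_cases hu : u ∈ A
        · simp [hgA u hu]
        · simp [hu]
      · by_cases hu : u ∈ Q
        · simp [hu]
        · simp [hg u hu]

/-- Resampling one coordinate of a product measure. -/
lemma measurePreserving_update {n : ℕ} (b : Fin n) :
    MeasurePreserving (fun p : (Fin n → V) × V => Function.update p.1 b p.2)
      ((Measure.pi fun _ : Fin n => μ).prod μ) (Measure.pi fun _ : Fin n => μ) := by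
  have hmeas : Measurable fun p : (Fin n → V) × V => Function.update p.1 b p.2 := by
    refine measurable_pi_lambda _ fun l => ?_
    by_cases hl : l = b
    · subst hl; simpa using measurable_snd
    · simpa [Function.update_of_ne hl, Function.comp_def] using
        (measurable_pi_apply l).comp (measurable_fst (α := Fin n → V) (β := V))
  refine ⟨hmeas, (Measure.pi_eq fun s hs => ?_).symm⟩
  rw [Measure.map_apply hmeas (MeasurableSet.univ_pi hs)]
  have e : (fun p : (Fin n → V) × V => Function.update p.1 b p.2) ⁻¹' Set.univ.pi s =
      (Set.univ.pi (Function.update s b Set.univ)) ×ˢ s b := by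
    ext ⟨x, u⟩
    simp only [Set.mem_preimage, Set.mem_pi, Set.mem_univ, true_imp_iff, Set.mem_prod]
    constructor
    · intro h
      refine ⟨fun l => ?_, by simpa using h b⟩
      by_cases hl : l = b
      · subst hl; simp
      · simpa [Function.update_of_ne hl] using h l
    · rintro ⟨h1, h2⟩ l
      by_cases hl : l = b
      · subst hl; simpa using h2
      · simpa [Function.update_of_ne hl] using h1 l
  rw [e, Measure.prod_prod, Measure.pi_pi,
    ← Finset.prod_erase_mul Finset.univ _ (Finset.mem_univ b),
    ← Finset.prod_erase_mul Finset.univ (fun i => μ (s i)) (Finset.mem_univ b)]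
  simp only [Function.update_self, measure_univ, mul_one]
  congr 1
  refine Finset.prod_congr rfl fun l hl => ?_
  rw [Function.update_of_ne (Finset.ne_of_mem_erase hl)]

/-- By Fubini it is enough to compare averages over one resampled node, the others being frozen.
This turns the pointwise effect of moving a node into a bound on expectations. -/
lemma integral_le_integral_of_update {n : ℕ} (b : Fin n) {F G : (Fin n → V) → ℝ}
    (hF : Integrable F (Measure.pi fun _ : Fin n => μ))
    (hG : Integrable G (Measure.pi fun _ : Fin n => μ))
    (hFG : ∀ᵐ x ∂(Measure.pi fun _ : Fin n => μ),
      ∫ u, F (Function.update x b u) ∂μ ≤ ∫ u, G (Function.update x b u) ∂μ) :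
    ∫ x, F x ∂(Measure.pi fun _ : Fin n => μ) ≤ ∫ x, G x ∂(Measure.pi fun _ : Fin n => μ) := by
  have hmp := measurePreserving_update μ b
  have key : ∀ H : (Fin n → V) → ℝ, Integrable H (Measure.pi fun _ : Fin n => μ) →
      Integrable (fun x => ∫ u, H (Function.update x b u) ∂μ) (Measure.pi fun _ : Fin n => μ) ∧
      ∫ x, H x ∂(Measure.pi fun _ : Fin n => μ) =
        ∫ x, ∫ u, H (Function.update x b u) ∂μ ∂(Measure.pi fun _ : Fin n => μ) := by
    intro H hH
    have hI : Integrable (fun p : (Fin n → V) × V => H (Function.update p.1 b p.2))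
        ((Measure.pi fun _ : Fin n => μ).prod μ) := hmp.integrable_comp_of_integrable hH
    refine ⟨hI.integral_prod_left, ?_⟩
    rw [← integral_prod _ hI]
    conv_lhs => rw [← hmp.map_eq]
    rw [integral_map hmp.measurable.aemeasurable]
    rw [hmp.map_eq]
    exact hH.aestronglyMeasurable
  rw [(key F hF).2, (key G hG).2]
  exact integral_mono_ae (key F hF).1 (key G hG).1 hFG

lemma measureReal_mul_setIntegral_le {B B' : Set V} (hB : MeasurableSet B)
    (hB' : MeasurableSet B') {F G : V → ℝ} (hF : Integrable F μ) (hG : Integrable G μ)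
    (hFG : ∀ u ∈ B, ∀ v ∈ B', F v ≤ G u) :
    μ.real B * ∫ v in B', F v ∂μ ≤ μ.real B' * ∫ u in B, G u ∂μ := by
  have h1 : ∀ u ∈ B, ∫ v in B', F v ∂μ ≤ μ.real B' * G u := by
    intro u hu
    have := setIntegral_mono_on (μ := μ) (g := fun _ => G u) hF.integrableOn
      (integrable_const _).integrableOn hB' (hFG u hu)
    simpa using this
  have h2 := setIntegral_mono_on (μ := μ) (f := fun _ => ∫ v in B', F v ∂μ)
    (g := fun u => μ.real B' * G u) (integrable_const _).integrableOn
    (hG.const_mul _).integrableOn hB h1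
  rwa [setIntegral_const, integral_const_mul, smul_eq_mul] at h2

/-- Cauchy–Schwarz for the centred `T`: the second moment of `T - c - t φ` is a nonnegative
quadratic in `t`, so its discriminant is not positive. -/
lemma sq_integral_mul_le_variance {Ω : Type*} [MeasurableSpace Ω] {P : Measure Ω}
    [IsProbabilityMeasure P] {T φ : Ω → ℝ} (hT : MemLp T 2 P) (hφ : MemLp φ 2 P)
    (h0 : ∫ x, φ x ∂P = 0) :
    (∫ x, T x * φ x ∂P) ^ 2 ≤ variance T P * ∫ x, φ x * φ x ∂P := by
  set c := ∫ x, T x ∂P with hc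
  have hTc : MemLp (fun x => T x - c) 2 P := hT.sub (memLp_const c)
  have hvar : variance T P = ∫ x, (T x - c) * (T x - c) ∂P := by
    rw [variance_eq_integral hT.aestronglyMeasurable.aemeasurable]
    simp only [sq, hc]
  have hI1 : Integrable (fun x => (T x - c) * (T x - c)) P := hTc.integrable_mul hTc
  have hI2 : Integrable (fun x => (T x - c) * φ x) P := hTc.integrable_mul hφ
  have hI3 : Integrable (fun x => φ x * φ x) P := hφ.integrable_mul hφ
  have hI4 : Integrable (fun x => T x * φ x) P := hT.integrable_mul hφ
  have hcov : ∫ x, (T x - c) * φ x ∂P = ∫ x, T x * φ x ∂P := by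
    simp only [sub_mul]
    rw [integral_sub hI4 ((hφ.integrable one_le_two).const_mul c), integral_const_mul, h0]
    ring
  have hquad : ∀ t : ℝ, 0 ≤ (∫ x, φ x * φ x ∂P) * (t * t) +
      (-2 * ∫ x, T x * φ x ∂P) * t + variance T P := by
    intro t
    have hpos : 0 ≤ ∫ x, (T x - c - t * φ x) * (T x - c - t * φ x) ∂P :=
      integral_nonneg fun x => mul_self_nonneg _
    have e : ∀ x, (T x - c - t * φ x) * (T x - c - t * φ x) =
        (T x - c) * (T x - c) - (2 * t) * ((T x - c) * φ x) + (t * t) * (φ x * φ x) := by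
      intro x; ring
    simp only [e] at hpos
    have hI5 : Integrable (fun x => (T x - c) * (T x - c) - (2 * t) * ((T x - c) * φ x)) P :=
      hI1.sub (hI2.const_mul _)
    rw [integral_add hI5 (hI3.const_mul _), integral_sub hI1 (hI2.const_mul _), integral_const_mul, integral_const_mul, hcov,
      ← hvar] at hpos
    linarith
  have := discrim_le_zero hquad
  rw [discrim] at this
  linarith

end Correlation

/-! ### Families of cells and the abstract variance bound. -/

section Cells

variable {V : Type*} [MeasurableSpace V] {J : Type*}

/-- Pairwise disjoint cells `Q j` in `S`, with three disjoint parts `A j`, `B j` and `B' j`. -/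
structure IsCellFamily (S : Set V) (A B B' Q : J → Set V) : Prop where
  measA : ∀ j, MeasurableSet (A j)
  measB : ∀ j, MeasurableSet (B j)
  measB' : ∀ j, MeasurableSet (B' j)
  measQ : ∀ j, MeasurableSet (Q j)
  subA : ∀ j, A j ⊆ Q j
  subB : ∀ j, B j ⊆ Q j
  subB' : ∀ j, B' j ⊆ Q j
  subQ : ∀ j, Q j ⊆ S
  disjAB : ∀ j, Disjoint (A j) (B j)
  disjAB' : ∀ j, Disjoint (A j) (B' j)
  disjBB' : ∀ j, Disjoint (B j) (B' j)
  disjQ : ∀ i j, i ≠ j → Disjoint (Q i) (Q j)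

namespace IsCellFamily

variable {S : Set V} {A B B' Q : J → Set V}

lemma contrast_eq_zero_of_notMem (hc : IsCellFamily S A B B' Q) (μ : Measure V) (j : J) {u : V}
    (hu : u ∉ Q j) : contrast μ (B j) (B' j) u = 0 := by
  have h1 : u ∉ B j := fun h => hu (hc.subB j h)
  have h2 : u ∉ B' j := fun h => hu (hc.subB' j h)
  simp [contrast, h1, h2]

lemma contrast_eq_zero_of_mem (hc : IsCellFamily S A B B' Q) (μ : Measure V) (j : J) {u : V}
    (hu : u ∈ A j) : contrast μ (B j) (B' j) u = 0 := by
  have h1 : u ∉ B j := fun h => (hc.disjAB j).le_bot ⟨hu, h⟩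
  have h2 : u ∉ B' j := fun h => (hc.disjAB' j).le_bot ⟨hu, h⟩
  simp [contrast, h1, h2]

/-- At most one pair of nodes, and one cell, contribute for a given second node of the pair. -/
lemma sum_pairProd_mul_indicator_le [Fintype J] (hc : IsCellFamily S A B B' Q) {n : ℕ}
    (L : Fin n → Set (Fin n → V)) (x : Fin n → V) {Λ : ℝ}
    (hcount : (Set.ncard {b | x ∈ L b ∧ ∃ j, x b ∈ B j} : ℝ) ≤ Λ) :
    ∑ p ∈ (Finset.univ : Finset J) ×ˢ (Finset.univ : Finset (Fin n)).offDiag,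
      pairProd (A p.1) (Q p.1) ((B p.1).indicator 1) p.2.1 p.2.2 x *
        (L p.2.2).indicator 1 x ≤ Λ := by
  classical
  set I := (Finset.univ : Finset J) ×ˢ (Finset.univ : Finset (Fin n)).offDiag with hI
  set E : J × Fin n × Fin n → Prop := fun p => (x p.2.1 ∈ A p.1 ∧ x p.2.2 ∈ B p.1 ∧
    ∀ l, l ≠ p.2.1 → l ≠ p.2.2 → x l ∉ Q p.1) ∧ x ∈ L p.2.2 with hE
  have e : ∀ p ∈ I, pairProd (A p.1) (Q p.1) ((B p.1).indicator 1) p.2.1 p.2.2 x *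
      (L p.2.2).indicator 1 x = if E p then 1 else 0 := by
    intro p hp
    have hp' : p.2.1 ≠ p.2.2 := by simpa [hI] using hp
    rw [pairProd_indicator hp', Set.indicator_apply]
    simp only [hE, Pi.one_apply]
    split_ifs <;> simp_all
  rw [Finset.sum_congr rfl e, Finset.sum_boole]
  refine le_trans ?_ hcount
  rw [Set.ncard_eq_toFinset_card' {b | x ∈ L b ∧ ∃ j, x b ∈ B j}]
  refine Nat.cast_le.2 (Finset.card_le_card_of_injOn (fun p => p.2.2) ?_ ?_)
  · intro p hp
    have hp2 := (Finset.mem_filter.1 hp).2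
    simp only [Set.coe_toFinset, Set.mem_ofPred_eq]
    exact ⟨hp2.2, p.1, hp2.1.2.1⟩
  · rintro ⟨j, a, b⟩ hp ⟨k, a', b'⟩ hq hbb
    obtain ⟨hp1, ⟨hpa, hpb, hpl⟩, -⟩ := Finset.mem_filter.1 hp
    obtain ⟨hq1, ⟨hqa, hqb, hql⟩, -⟩ := Finset.mem_filter.1 hq
    have hne : a' ≠ b' := by simpa [hI] using hq1
    simp only at hpa hpb hpl hqa hqb hql hbb
    subst hbb
    -- The position of `b` determines the cell, and `a` is then the only other node in that cell.
    have hjk : j = k := by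
      by_contra h
      exact (hc.disjQ j k h).le_bot ⟨hc.subB j hpb, hc.subB k hqb⟩
    subst hjk
    have haa : a = a' := by
      by_contra h
      exact hpl a' (Ne.symm h) hne (hc.subA j hqa)
    rw [haa]

variable (μ : Measure V) [IsProbabilityMeasure μ]

/-- `F v ≤ F u - G u` is averaged over `u ∈ B j` and `v ∈ B' j`; the contrast compares exactly these
two averages of `F`. -/
lemma integral_contrast_mul_ge (hc : IsCellFamily S A B B' Q) (j : J) {F G : V → ℝ}
    (hF : Integrable F μ) (hG : Integrable G μ)
    (hFG : ∀ u ∈ B j, ∀ v ∈ B' j, F v ≤ F u - G u) :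
    ∫ u, μ.real (B' j) * ((B j).indicator 1 u * G u) ∂μ ≤
      ∫ u, contrast μ (B j) (B' j) u * F u ∂μ := by
  rw [integral_contrast_mul μ (hc.measB j) (hc.measB' j) hF, integral_const_mul]
  have e : ∀ u, (B j).indicator 1 u * G u = (B j).indicator G u := by
    intro u
    by_cases hu : u ∈ B j <;> simp [hu]
  simp only [e]
  rw [integral_indicator (hc.measB j)]
  have := measureReal_mul_setIntegral_le μ (hc.measB j) (hc.measB' j) hF
    (hF.sub hG) hFG
  simp only [Pi.sub_apply] at this
  rw [integral_sub hF.integrableOn hG.integrableOn] at this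
  linarith

/-- The correlation of `T` with one test function, when moving a node from `B j` to `B' j`
lowers `T` by at least `W`. -/
lemma integral_mul_pairProd_ge (hc : IsCellFamily S A B B' Q) (hS : ∀ᵐ u ∂μ, u ∈ S) {n : ℕ}
    {T W : (Fin n → V) → ℝ} (hT : Measurable T) (hW : Measurable W) {K K' : ℝ}
    (hTK : ∀ x, |T x| ≤ K) (hWK : ∀ x, |W x| ≤ K') (j : J) {a b : Fin n} (hab : a ≠ b)
    (hmove : ∀ x : Fin n → V, (∀ i, x i ∈ S) → x a ∈ A j → x b ∈ B j →
      (∀ l, l ≠ a → l ≠ b → x l ∉ Q j) → ∀ v ∈ B' j, T (Function.update x b v) ≤ T x - W x) :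
    ∫ x, μ.real (B' j) * (pairProd (A j) (Q j) ((B j).indicator 1) a b x * W x)
        ∂(Measure.pi fun _ : Fin n => μ) ≤
      ∫ x, T x * pairProd (A j) (Q j) (contrast μ (B j) (B' j)) a b x
        ∂(Measure.pi fun _ : Fin n => μ) := by
  have hg := measurable_contrast (μ := μ) (hc.measB j) (hc.measB' j)
  have hφ := measurable_pairProd (hc.measA j) (hc.measQ j) hg a b
  have he := measurable_pairProd (hc.measA j) (hc.measQ j)
    (measurable_one.indicator (hc.measB j) : Measurable ((B j).indicator (1 : V → ℝ))) a b
  have hφ1 := abs_pairProd_le (A := A j) (Q := Q j) (abs_contrast_le μ (hc.disjBB' j)) a b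
  have he1 := abs_pairProd_le (A := A j) (Q := Q j) (abs_indicator_one_le (B j)) a b
  have hnn : ∀ {p q r s : ℝ}, |p| ≤ r → |q| ≤ s → |p * q| ≤ r * s := fun h1 h2 => by
    rw [abs_mul]; exact mul_le_mul h1 h2 (abs_nonneg _) ((abs_nonneg _).trans h1)
  refine integral_le_integral_of_update μ b ?_ ?_ ?_
  · exact (Integrable.of_bound (he.mul hW).aestronglyMeasurable (1 * K')
      (ae_of_all _ fun x => hnn (he1 x) (hWK x))).const_mul _
  · exact Integrable.of_bound (hT.mul hφ).aestronglyMeasurable (K * 1)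
      (ae_of_all _ fun x => hnn (hTK x) (hφ1 x))
  have hall : ∀ᵐ x ∂(Measure.pi fun _ : Fin n => μ), ∀ i, x i ∈ S :=
    ae_all_iff.2 fun i => (measurePreserving_eval (fun _ : Fin n => μ) i).quasiMeasurePreserving.ae hS
  filter_upwards [hall] with x hx
  -- `R` collects the factors that do not depend on node `b`. The `0` is a dummy, as coordinate `b`
  -- is left out. If `R ≠ 0`, the frozen nodes satisfy the hypotheses of `hmove`.
  set R : ℝ := ∏ l ∈ Finset.univ.erase b, pairFactor (A j) (Q j) 0 a b l (x l) with hR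
  have hsplit : ∀ (g : V → ℝ) (u : V),
      pairProd (A j) (Q j) g a b (Function.update x b u) = R * g u := by
    intro g u
    rw [pairProd, ← Finset.prod_erase_mul Finset.univ _ (Finset.mem_univ b), hR]
    congr 1
    · refine Finset.prod_congr rfl fun l hl => ?_
      have hlb := Finset.ne_of_mem_erase hl
      simp [pairFactor, hlb]
    · simp [pairFactor, hab.symm]
  have e1 : ∀ u, μ.real (B' j) * (pairProd (A j) (Q j) ((B j).indicator 1) a b
      (Function.update x b u) * W (Function.update x b u)) =
      R * (μ.real (B' j) * ((B j).indicator 1 u * W (Function.update x b u))) := by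
    intro u; rw [hsplit]; ring
  have e2 : ∀ u, T (Function.update x b u) * pairProd (A j) (Q j) (contrast μ (B j) (B' j)) a b
      (Function.update x b u) =
      R * (contrast μ (B j) (B' j) u * T (Function.update x b u)) := by
    intro u; rw [hsplit]; ring
  simp only [e1, e2]
  rw [integral_const_mul R, integral_const_mul R]
  by_cases hR0 : R = 0
  · rw [hR0, zero_mul, zero_mul]
  have hfac : ∀ l, l ≠ b → pairFactor (A j) (Q j) 0 a b l (x l) ≠ 0 := fun l hl =>
    (Finset.prod_ne_zero_iff.1 hR0) l (Finset.mem_erase.2 ⟨hl, Finset.mem_univ l⟩)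
  have hRpos : 0 ≤ R := by
    refine Finset.prod_nonneg fun l hl => ?_
    have hlb := Finset.ne_of_mem_erase hl
    unfold pairFactor
    rw [if_neg hlb]
    split_ifs <;> exact Set.indicator_nonneg (fun _ _ => zero_le_one) _
  have hxa : x a ∈ A j := by
    by_contra hne
    exact hfac a hab (by simp [pairFactor, hne])
  have hxl : ∀ l, l ≠ a → l ≠ b → x l ∉ Q j := by
    intro l hla hlb hl
    exact hfac l hlb (by simp [pairFactor, hla, hlb, hl])
  have hupd : Measurable fun u : V => Function.update x b u := measurable_update x
  refine mul_le_mul_of_nonneg_left (hc.integral_contrast_mul_ge μ j ?_ ?_ ?_) hRpos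
  · exact Integrable.of_bound (hT.comp hupd).aestronglyMeasurable K (ae_of_all _ fun u => hTK _)
  · exact Integrable.of_bound (hW.comp hupd).aestronglyMeasurable K' (ae_of_all _ fun u => hWK _)
  · intro u hu v hv
    have := hmove (Function.update x b u) (fun i => ?_) ?_ ?_ ?_ v hv
    · simpa using this
    · by_cases hi : i = b
      · subst hi; simpa using hc.subQ j (hc.subB j hu)
      · simpa [Function.update_of_ne hi] using hx i
    · simpa [Function.update_of_ne hab] using hxa
    · simpa using hu
    · intro l hla hlb
      simpa [Function.update_of_ne hlb] using hxl l hla hlb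

/-- `κ` is the gain of a move, `L b` the bad event on which the gain may fall to `κ - C`, and `Λ`
bounds the number of bad nodes. Counting bad nodes for each configuration, rather than bounding each
event separately, keeps the total error at `M * C * Λ`. -/
theorem sq_le_variance_mul [Fintype J] (hc : IsCellFamily S A B B' Q)
    (hS : ∀ᵐ u ∂μ, u ∈ S) {n : ℕ} {T : (Fin n → V) → ℝ} (hT : Measurable T) {K : ℝ}
    (hTK : ∀ x, |T x| ≤ K) {L : Fin n → Set (Fin n → V)} (hL : ∀ b, MeasurableSet (L b))
    {m M : ℝ} (hm : 0 ≤ m) (hmA : ∀ j, m ≤ μ.real (A j)) (hmB : ∀ j, m ≤ μ.real (B j))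
    (hmB' : ∀ j, m ≤ μ.real (B' j)) (hMA : ∀ j, μ.real (A j) ≤ M) (hMB : ∀ j, μ.real (B j) ≤ M)
    (hMB' : ∀ j, μ.real (B' j) ≤ M) (hM : 0 ≤ M) (hQ : ∀ j, n * μ.real (Q j) ≤ 1 / 2)
    {κ C Λ : ℝ} (hκ : 0 ≤ κ) (hC : 0 ≤ C)
    (hmove : ∀ x : Fin n → V, (∀ i, x i ∈ S) → ∀ (j : J) (a b : Fin n), a ≠ b → x a ∈ A j →
      x b ∈ B j → (∀ l, l ≠ a → l ≠ b → x l ∉ Q j) → ∀ v ∈ B' j,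
      T (Function.update x b v) ≤ T x - (κ - C * (L b).indicator 1 x))
    (hcount : ∀ x : Fin n → V, (∀ i, x i ∈ S) →
      (Set.ncard {b | x ∈ L b ∧ ∃ j, x b ∈ B j} : ℝ) ≤ Λ)
    (hy : 0 ≤ m * κ * (Fintype.card J * (n * n - n : ℕ) * (m * m / 2)) - M * C * Λ) :
    (m * κ * (Fintype.card J * (n * n - n : ℕ) * (m * m / 2)) - M * C * Λ) ^ 2 ≤
      variance T (Measure.pi fun _ : Fin n => μ) *
        (Fintype.card J * (n * n - n : ℕ) * (2 * M ^ 4)) := by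
  classical
  set I := (Finset.univ : Finset J) ×ˢ (Finset.univ : Finset (Fin n)).offDiag with hI
  have hIcard : (I.card : ℝ) = Fintype.card J * (n * n - n : ℕ) := by
    rw [hI, Finset.card_product, Finset.offDiag_card]
    simp
  have hIne : ∀ p ∈ I, p.2.1 ≠ p.2.2 := fun p hp => by simpa [hI] using hp
  set g : J → V → ℝ := fun j => contrast μ (B j) (B' j) with hg
  set φ : J × Fin n × Fin n → (Fin n → V) → ℝ :=
    fun p => pairProd (A p.1) (Q p.1) (g p.1) p.2.1 p.2.2 with hφ
  set e : J × Fin n × Fin n → (Fin n → V) → ℝ :=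
    fun p => pairProd (A p.1) (Q p.1) ((B p.1).indicator 1) p.2.1 p.2.2 with he
  set ν : Measure (Fin n → V) := Measure.pi fun _ : Fin n => μ with hν
  have hgm : ∀ j, Measurable (g j) := fun j => measurable_contrast (hc.measB j) (hc.measB' j)
  have hφm : ∀ p, Measurable (φ p) := fun p =>
    measurable_pairProd (hc.measA _) (hc.measQ _) (hgm _) _ _
  have hem : ∀ p, Measurable (e p) := fun p =>
    measurable_pairProd (hc.measA _) (hc.measQ _) (measurable_one.indicator (hc.measB _)) _ _
  have hφ1 : ∀ p x, |φ p x| ≤ 1 := fun p x =>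
    abs_pairProd_le (abs_contrast_le μ (hc.disjBB' _)) _ _ x
  have he1 : ∀ p x, |e p x| ≤ 1 := fun p x => abs_pairProd_le (abs_indicator_one_le _) _ _ x
  have hφL : ∀ p, MemLp (φ p) 2 ν := fun p =>
    MemLp.of_bound (hφm p).aestronglyMeasurable 1 (ae_of_all _ (hφ1 p))
  have hTL : MemLp T 2 ν := MemLp.of_bound hT.aestronglyMeasurable K (ae_of_all _ hTK)
  have hsumL : MemLp (fun x => ∑ p ∈ I, φ p x) 2 ν := memLp_finsetSum _ fun p _ => hφL p
  have hφφ : ∀ p q, Integrable (fun x => φ p x * φ q x) ν := fun p q =>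
    (hφL p).integrable_mul (hφL q)
  have hTφ : ∀ p, Integrable (fun x => T x * φ p x) ν := fun p => hTL.integrable_mul (hφL p)
  have hzero : ∫ x, ∑ p ∈ I, φ p x ∂ν = 0 := by
    rw [integral_finsetSum _ fun p _ => (hφL p).integrable one_le_two]
    refine Finset.sum_eq_zero fun p hp => ?_
    rw [hφ, hν, integral_pairProd μ (hc.measA _) (hc.measQ _) (hIne p hp),
      integral_contrast μ (hc.measB _) (hc.measB' _)]
    ring
  have hsq : ∫ x, (∑ p ∈ I, φ p x) * (∑ p ∈ I, φ p x) ∂ν ≤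
      Fintype.card J * (n * n - n : ℕ) * (2 * M ^ 4) := by
    simp only [Finset.sum_mul_sum]
    rw [integral_finsetSum _ fun p _ => integrable_finsetSum _ fun q _ => hφφ p q]
    rw [← hIcard, ← nsmul_eq_mul]
    refine Finset.sum_le_card_nsmul _ _ _ fun p hp => ?_
    rw [integral_finsetSum _ fun q _ => hφφ p q]
    -- By orthogonality only the diagonal terms survive.
    rw [Finset.sum_eq_single_of_mem p hp]
    · refine (integral_pairProd_mul_self_le μ (hc.measA _) (hc.measQ _) (hIne p hp)).trans ?_
      calc μ.real (A p.1) * ∫ u, g p.1 u * g p.1 u ∂μ ≤ M * (2 * M ^ 3) :=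
            mul_le_mul (hMA _) (integral_contrast_sq_le μ (hc.measB _) (hc.measB' _)
              (hc.disjBB' _) (hMB _) (hMB' _)) (integral_nonneg fun u => mul_self_nonneg _) hM
        _ = 2 * M ^ 4 := by ring
    · intro q hq hqp
      refine integral_pairProd_mul_eq_zero μ (hc.subA _) (hc.subA _)
        (fun u hu => hc.contrast_eq_zero_of_notMem μ _ hu)
        (fun u hu => hc.contrast_eq_zero_of_notMem μ _ hu)
        (fun u hu => hc.contrast_eq_zero_of_mem μ _ hu)
        (integral_contrast μ (hc.measB _) (hc.measB' _)) (hIne p hp) (hIne q hq) ?_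
      by_cases hj : p.1 = q.1
      · refine Or.inr ⟨by rw [hj], by rw [hj], fun h => hqp ?_⟩
        exact (Prod.ext hj h).symm
      · exact Or.inl (hc.disjQ _ _ hj)
  have hWm : ∀ b, Measurable fun x => κ - C * (L b).indicator (1 : (Fin n → V) → ℝ) x := fun b =>
    measurable_const.sub ((measurable_one.indicator (hL b)).const_mul C)
  have hWK : ∀ b x, |κ - C * (L b).indicator (1 : (Fin n → V) → ℝ) x| ≤ κ + C := by
    intro b x
    have := abs_le.1 (abs_indicator_one_le (L b) x)
    rw [abs_le]
    constructor <;> nlinarith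
  have heLm : ∀ p, Integrable (fun x => e p x * (L p.2.2).indicator 1 x) ν := fun p =>
    Integrable.of_bound ((hem p).mul (measurable_one.indicator (hL _))).aestronglyMeasurable
      (1 * 1) (ae_of_all _ fun x => by
        rw [Real.norm_eq_abs, abs_mul]
        exact mul_le_mul (he1 p x) (abs_indicator_one_le _ _) (abs_nonneg _) zero_le_one)
  have heI : ∀ p, Integrable (e p) ν := fun p =>
    Integrable.of_bound (hem p).aestronglyMeasurable 1 (ae_of_all _ (he1 p))
  have he0 : ∀ p ∈ I, ∀ x, 0 ≤ e p x := by
    intro p hp x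
    simp only [he]
    rw [pairProd_indicator (hIne p hp)]
    split_ifs <;> norm_num
  have hall : ∀ᵐ x ∂ν, ∀ i, x i ∈ S :=
    ae_all_iff.2 fun i => (measurePreserving_eval (fun _ : Fin n => μ) i).quasiMeasurePreserving.ae hS
  have hlow : m * κ * (Fintype.card J * (n * n - n : ℕ) * (m * m / 2)) - M * C * Λ ≤
      ∫ x, T x * ∑ p ∈ I, φ p x ∂ν := by
    simp only [Finset.mul_sum]
    rw [integral_finsetSum _ fun p _ => hTφ p]
    -- The error integral is kept inside each term. It is bounded only after summation over `I`,
    -- where the count `Λ` applies.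
    have hterm : ∀ p ∈ I, m * κ * (m * m / 2) -
        M * C * ∫ x, e p x * (L p.2.2).indicator 1 x ∂ν ≤ ∫ x, T x * φ p x ∂ν := by
      intro p hp
      refine le_trans ?_ (hc.integral_mul_pairProd_ge μ hS hT (hWm p.2.2) hTK (hWK _) p.1
        (hIne p hp) fun x hx => hmove x hx p.1 p.2.1 p.2.2 (hIne p hp))
      have e3 : ∀ x, pairProd (A p.1) (Q p.1) ((B p.1).indicator 1) p.2.1 p.2.2 x *
          (κ - C * (L p.2.2).indicator 1 x) =
          κ * e p x - C * (e p x * (L p.2.2).indicator 1 x) := by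
        intro x; simp only [he]; ring
      simp only [e3]
      rw [integral_const_mul, integral_sub ((heI p).const_mul _) ((heLm p).const_mul _),
        integral_const_mul, integral_const_mul]
      have h1 : m * m / 2 ≤ ∫ x, e p x ∂ν := by
        refine le_trans ?_ (half_mul_le_integral_pairProd μ (hc.measA p.1) (hc.measB p.1)
          (hc.measQ p.1) (hQ p.1) (hIne p hp))
        have := mul_le_mul (hmA p.1) (hmB p.1) hm (hm.trans (hmA p.1))
        linarith
      have h2 : 0 ≤ ∫ x, e p x * (L p.2.2).indicator 1 x ∂ν :=
        integral_nonneg fun x => mul_nonneg (he0 p hp x)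
          (Set.indicator_nonneg (fun _ _ => zero_le_one) _)
      have h3 : m * κ * (m * m / 2) ≤ μ.real (B' p.1) * (κ * ∫ x, e p x ∂ν) := by
        rw [mul_assoc]
        exact mul_le_mul (hmB' _) (mul_le_mul_of_nonneg_left h1 hκ) (by positivity)
          measureReal_nonneg
      have h4 := mul_le_mul_of_nonneg_right (hMB' p.1) (mul_nonneg hC h2)
      rw [mul_sub]
      linarith
    refine le_trans ?_ (Finset.sum_le_sum hterm)
    rw [Finset.sum_sub_distrib, Finset.sum_const, nsmul_eq_mul, hIcard, ← Finset.mul_sum,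
      ← integral_finsetSum _ fun p _ => heLm p]
    have h5 : ∫ x, ∑ p ∈ I, e p x * (L p.2.2).indicator 1 x ∂ν ≤ Λ := by
      have := integral_mono_ae (integrable_finsetSum I fun p _ => heLm p) (integrable_const Λ)
        (hall.mono fun x hx => hc.sum_pairProd_mul_indicator_le L x (hcount x hx))
      simpa using this
    have h6 := mul_le_mul_of_nonneg_left h5 (mul_nonneg hM hC)
    linarith
  calc _ ≤ (∫ x, T x * ∑ p ∈ I, φ p x ∂ν) ^ 2 := by gcongr
    _ ≤ _ := sq_integral_mul_le_variance hTL hsumL hzero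
    _ ≤ _ := mul_le_mul_of_nonneg_left hsq (variance_nonneg _ _)

end IsCellFamily

end Cells

/-! ### Boxes in a tilted square -/

/-- The half-open square of side length `ℓ` with lower left corner `p`, in the coordinates of the
isometry `e`. -/
def tiltedBox (e : Plane ≃ᵃⁱ[ℝ] Plane) (p : ℝ × ℝ) (ℓ : ℝ) : Set Plane :=
  {x | e.symm x 0 ∈ Set.Ico p.1 (p.1 + ℓ) ∧ e.symm x 1 ∈ Set.Ico p.2 (p.2 + ℓ)}

lemma measurable_symm_apply (e : Plane ≃ᵃⁱ[ℝ] Plane) (i : Fin 2) :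
    Measurable fun x => e.symm x i :=
  ((EuclideanSpace.proj i : Plane →L[ℝ] ℝ).continuous.comp
    e.symm.continuous).measurable

lemma measurableSet_tiltedBox (e : Plane ≃ᵃⁱ[ℝ] Plane) (p : ℝ × ℝ) (ℓ : ℝ) :
    MeasurableSet (tiltedBox e p ℓ) :=
  (measurable_symm_apply e 0 measurableSet_Ico).inter (measurable_symm_apply e 1 measurableSet_Ico)

lemma measurePreserving_affineIsometryEquiv (e : Plane ≃ᵃⁱ[ℝ] Plane) :
    MeasurePreserving e volume volume := by
  have h1 : (e : Plane → Plane) = (fun x => x + e 0) ∘ e.linearIsometryEquiv := by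
    ext1 x
    have := e.map_vadd 0 x
    simpa [vadd_eq_add] using this
  rw [h1]
  exact (measurePreserving_add_right volume (e 0)).comp e.linearIsometryEquiv.measurePreserving

lemma volume_tiltedBox (e : Plane ≃ᵃⁱ[ℝ] Plane) (p : ℝ × ℝ) {ℓ : ℝ} (hℓ : 0 ≤ ℓ) :
    volume (tiltedBox e p ℓ) = ENNReal.ofReal (ℓ ^ 2) := by
  have h1 : tiltedBox e p ℓ = e.symm ⁻¹' ((MeasurableEquiv.toLp 2 (Fin 2 → ℝ)).symm ⁻¹'
      Set.univ.pi fun i => Set.Ico (![p.1, p.2] i) (![p.1 + ℓ, p.2 + ℓ] i)) := by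
    ext x
    simp [tiltedBox, Set.mem_pi, Fin.forall_fin_two]
  have hm : MeasurableSet
      (Set.univ.pi fun i : Fin 2 => Set.Ico (![p.1, p.2] i) (![p.1 + ℓ, p.2 + ℓ] i)) :=
    MeasurableSet.univ_pi fun i => measurableSet_Ico
  have hv := EuclideanSpace.volume_preserving_symm_measurableEquiv_toLp (Fin 2)
  rw [h1, (measurePreserving_affineIsometryEquiv e.symm).measure_preimage
    (hv.measurable hm).nullMeasurableSet, hv.measure_preimage hm.nullMeasurableSet,
    Real.volume_pi_Ico]
  simp [Fin.prod_univ_two, sq, ENNReal.ofReal_mul hℓ]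

lemma measurableSet_unitSquare : MeasurableSet unitSquare := by
  have : unitSquare = ⋂ i : Fin 2, {x : Plane | x i ∈ Set.Icc (-(1 / 2) : ℝ) (1 / 2)} := by
    ext x; simp [unitSquare]
  rw [this]
  exact MeasurableSet.iInter fun i =>
    (EuclideanSpace.proj i : Plane →L[ℝ] ℝ).continuous.measurable
      measurableSet_Icc

lemma ae_mem_unitSquare (f : Plane → ℝ) : ∀ᵐ x ∂(nodeLaw f), x ∈ unitSquare :=
  (withDensity_absolutelyContinuous _ _).ae_le (ae_restrict_mem measurableSet_unitSquare)

lemma nodeLaw_tiltedBox_bounds {f : Plane → ℝ} {ε₁ ε₂ : ℝ} (hε₁ : 0 ≤ ε₁)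
    (hf_bounds : ∀ x ∈ unitSquare, ε₁ ≤ f x ∧ f x ≤ ε₂) (hε₂ : 0 ≤ ε₂)
    (e : Plane ≃ᵃⁱ[ℝ] Plane) (p : ℝ × ℝ) {ℓ : ℝ} (hℓ : 0 ≤ ℓ)
    (hsub : tiltedBox e p ℓ ⊆ unitSquare) :
    ε₁ * ℓ ^ 2 ≤ (nodeLaw f).real (tiltedBox e p ℓ) ∧
      (nodeLaw f).real (tiltedBox e p ℓ) ≤ ε₂ * ℓ ^ 2 := by
  have hm := measurableSet_tiltedBox e p ℓ
  have h1 : nodeLaw f (tiltedBox e p ℓ) = ∫⁻ x in tiltedBox e p ℓ, ENNReal.ofReal (f x) := by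
    rw [nodeLaw, withDensity_apply _ hm, Measure.restrict_restrict hm,
      Set.inter_eq_left.2 hsub]
  have hup : nodeLaw f (tiltedBox e p ℓ) ≤ ENNReal.ofReal (ε₂ * ℓ ^ 2) := by
    rw [h1, ENNReal.ofReal_mul hε₂, ← volume_tiltedBox e p hℓ, ← setLIntegral_const]
    exact setLIntegral_mono' hm fun x hx => ENNReal.ofReal_le_ofReal (hf_bounds x (hsub hx)).2
  have hlow : ENNReal.ofReal (ε₁ * ℓ ^ 2) ≤ nodeLaw f (tiltedBox e p ℓ) := by
    rw [h1, ENNReal.ofReal_mul hε₁, ← volume_tiltedBox e p hℓ, ← setLIntegral_const]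
    exact setLIntegral_mono' hm fun x hx => ENNReal.ofReal_le_ofReal (hf_bounds x (hsub hx)).1
  have hfin : nodeLaw f (tiltedBox e p ℓ) ≠ ⊤ := (hup.trans_lt ENNReal.ofReal_lt_top).ne
  exact ⟨(ENNReal.ofReal_le_iff_le_toReal hfin).1 hlow,
    ENNReal.toReal_le_of_le_ofReal (by positivity) hup⟩

lemma abs_symm_sub_le_dist (e : Plane ≃ᵃⁱ[ℝ] Plane) (x y : Plane) (i : Fin 2) :
    |e.symm x i - e.symm y i| ≤ dist x y := by
  rw [← e.symm.dist_map x y, EuclideanSpace.dist_eq]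
  refine Real.abs_le_sqrt ?_
  have h := Finset.single_le_sum
    (f := fun k : Fin 2 => dist ((e.symm x) k) ((e.symm y) k) ^ 2)
    (fun k _ => sq_nonneg _) (Finset.mem_univ i)
  simpa [Real.dist_eq, sq_abs] using h

lemma dist_le_abs_symm_add (e : Plane ≃ᵃⁱ[ℝ] Plane) (x y : Plane) :
    dist x y ≤ |e.symm x 0 - e.symm y 0| + |e.symm x 1 - e.symm y 1| := by
  rw [← e.symm.dist_map x y, EuclideanSpace.dist_eq, Fin.sum_univ_two,
    Real.sqrt_le_iff, Real.dist_eq, Real.dist_eq]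
  refine ⟨by positivity, ?_⟩
  nlinarith [mul_nonneg (abs_nonneg (e.symm x 0 - e.symm y 0))
    (abs_nonneg (e.symm x 1 - e.symm y 1))]

lemma mem_image_square_iff (e : Plane ≃ᵃⁱ[ℝ] Plane) (s : ℝ) (x : Plane) :
    x ∈ e '' {y : Plane | ∀ i, y i ∈ Set.Icc (0 : ℝ) s} ↔ ∀ i, e.symm x i ∈ Set.Icc (0 : ℝ) s := by
  constructor
  · rintro ⟨y, hy, rfl⟩
    simpa using hy
  · intro hx
    exact ⟨e.symm x, hx, by simp⟩

/-- The lower left corners of a grid of `N ^ 2` cells in the central half of `[0, s] ^ 2`. -/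
noncomputable def gridCorner (s : ℝ) {N : ℕ} (j : Fin N × Fin N) : ℝ × ℝ :=
  (s / 4 + s / (2 * N) * (j.1 : ℕ), s / 4 + s / (2 * N) * (j.2 : ℕ))

/-! ### The grid of cells, its parts and their distances. -/

section Grid

variable {e : Plane ≃ᵃⁱ[ℝ] Plane} {s r : ℝ} {N : ℕ}

lemma grid_coord_bounds (hs : 0 < s) (hr : r ≤ s / (2 * N)) (i : Fin N) :
    s / 4 ≤ s / 4 + s / (2 * N) * (i : ℕ) ∧ s / 4 + s / (2 * N) * (i : ℕ) + r ≤ 3 * s / 4 := by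
  have hN : (0 : ℝ) < N := by exact_mod_cast i.pos
  have hi : ((i : ℕ) : ℝ) + 1 ≤ N := by exact_mod_cast i.isLt
  have h0 : 0 < s / (2 * N) := by positivity
  have h1 : s / (2 * N) * N = s / 2 := by field_simp
  constructor
  · have : 0 ≤ s / (2 * N) * (i : ℕ) := by positivity
    linarith
  · nlinarith [mul_le_mul_of_nonneg_left hi h0.le]

lemma tiltedBox_gridCorner_central (hs : 0 < s) (hr : r ≤ s / (2 * N)) (j : Fin N × Fin N)
    {x : Plane} (hx : x ∈ tiltedBox e (gridCorner s j) r) (i : Fin 2) :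
    s / 4 ≤ e.symm x i ∧ e.symm x i ≤ 3 * s / 4 := by
  obtain ⟨h0, h1⟩ := hx
  simp only [gridCorner, Set.mem_Ico] at h0 h1
  have b0 := grid_coord_bounds hs hr j.1
  have b1 := grid_coord_bounds hs hr j.2
  fin_cases i
  · exact ⟨b0.1.trans h0.1, h0.2.le.trans b0.2⟩
  · exact ⟨b1.1.trans h1.1, h1.2.le.trans b1.2⟩

lemma grid_coord_ne (hs : 0 < s) (hr : r ≤ s / (2 * N)) {i k : Fin N} (hik : i ≠ k) {u : ℝ}
    (hi : u ∈ Set.Ico (s / 4 + s / (2 * N) * (i : ℕ)) (s / 4 + s / (2 * N) * (i : ℕ) + r))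
    (hk : u ∈ Set.Ico (s / 4 + s / (2 * N) * (k : ℕ)) (s / 4 + s / (2 * N) * (k : ℕ) + r)) :
    False := by
  have hN : (0 : ℝ) < N := by exact_mod_cast i.pos
  have h0 : 0 < s / (2 * N) := by positivity
  rcases lt_or_gt_of_ne hik with h | h
  · have : ((i : ℕ) : ℝ) + 1 ≤ (k : ℕ) := by exact_mod_cast h
    nlinarith [mul_le_mul_of_nonneg_left this h0.le, hi.2, hk.1]
  · have : ((k : ℕ) : ℝ) + 1 ≤ (i : ℕ) := by exact_mod_cast h
    nlinarith [mul_le_mul_of_nonneg_left this h0.le, hk.2, hi.1]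

/-- The part of a grid cell that holds a base node. -/
noncomputable def basePart (e : Plane ≃ᵃⁱ[ℝ] Plane) (s r δ : ℝ) (j : Fin N × Fin N) : Set Plane :=
  tiltedBox e (gridCorner s j) (δ * r)

/-- The part of a grid cell that is next to the base part. -/
noncomputable def nearPart (e : Plane ≃ᵃⁱ[ℝ] Plane) (s r δ : ℝ) (j : Fin N × Fin N) : Set Plane :=
  tiltedBox e (gridCorner s j + (δ * r, 0)) (δ * r)

/-- The part of a grid cell that is far from the base part and from the other cells. -/
noncomputable def farPart (e : Plane ≃ᵃⁱ[ℝ] Plane) (s r δ : ℝ) (j : Fin N × Fin N) : Set Plane :=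
  tiltedBox e (gridCorner s j + (r / 2, r / 2)) (δ * r)

variable {δ : ℝ}

lemma isCellFamily_grid {S : Set Plane} (hs : 0 < s) (hr0 : 0 < r) (hr : r ≤ s / (2 * N))
    (hδ0 : 0 < δ) (hδ : δ ≤ 1 / 12)
    (hS : e '' {y : Plane | ∀ i, y i ∈ Set.Icc (0 : ℝ) s} ⊆ S) :
    IsCellFamily S (basePart (N := N) e s r δ) (farPart e s r δ) (nearPart e s r δ)
      (fun j => tiltedBox e (gridCorner s j) r) where
  measA _ := measurableSet_tiltedBox _ _ _
  measB _ := measurableSet_tiltedBox _ _ _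
  measB' _ := measurableSet_tiltedBox _ _ _
  measQ _ := measurableSet_tiltedBox _ _ _
  subA j x hx := by
    simp only [basePart, tiltedBox, Set.mem_ofPred_eq, Set.mem_Ico] at hx ⊢
    refine ⟨⟨?_, ?_⟩, ?_, ?_⟩ <;> nlinarith
  subB j x hx := by
    simp only [farPart, tiltedBox, Set.mem_ofPred_eq, Set.mem_Ico, Prod.fst_add,
      Prod.snd_add] at hx ⊢
    refine ⟨⟨?_, ?_⟩, ?_, ?_⟩ <;> nlinarith
  subB' j x hx := by
    simp only [nearPart, tiltedBox, Set.mem_ofPred_eq, Set.mem_Ico, Prod.fst_add,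
      Prod.snd_add] at hx ⊢
    have : 0 < δ * r := mul_pos hδ0 hr0
    refine ⟨⟨?_, ?_⟩, ?_, ?_⟩ <;> nlinarith
  subQ j x hx := by
    refine hS ((mem_image_square_iff e s x).2 fun i => ?_)
    have := tiltedBox_gridCorner_central hs hr j hx i
    exact ⟨by linarith [this.1], by linarith [this.2]⟩
  disjAB j := Set.disjoint_left.2 fun x hx hx' => by
    simp only [basePart, farPart, tiltedBox, Set.mem_ofPred_eq, Set.mem_Ico, Prod.fst_add,
      Prod.snd_add] at hx hx'
    nlinarith [hx.1.2, hx'.1.1]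
  disjAB' j := Set.disjoint_left.2 fun x hx hx' => by
    simp only [basePart, nearPart, tiltedBox, Set.mem_ofPred_eq, Set.mem_Ico, Prod.fst_add,
      Prod.snd_add] at hx hx'
    linarith [hx.1.2, hx'.1.1]
  disjBB' j := Set.disjoint_left.2 fun x hx hx' => by
    simp only [farPart, nearPart, tiltedBox, Set.mem_ofPred_eq, Set.mem_Ico, Prod.fst_add,
      Prod.snd_add] at hx hx'
    nlinarith [hx.1.1, hx'.1.2]
  disjQ i j hij := Set.disjoint_left.2 fun x hx hx' => by
    simp only [tiltedBox, gridCorner, Set.mem_ofPred_eq] at hx hx'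
    by_cases h : i.1 = j.1
    · exact grid_coord_ne hs hr (fun h2 => hij (Prod.ext h h2)) hx.2 hx'.2
    · exact grid_coord_ne hs hr h hx.1 hx'.1

lemma dist_basePart_nearPart_le {j : Fin N × Fin N} {u v : Plane}
    (hu : u ∈ nearPart e s r δ j) (hv : v ∈ basePart e s r δ j) : dist u v ≤ 3 * δ * r := by
  simp only [basePart, nearPart, tiltedBox, Set.mem_ofPred_eq, Set.mem_Ico, Prod.fst_add,
      Prod.snd_add] at hu hv
  refine (dist_le_abs_symm_add e u v).trans ?_
  have h0 : |e.symm u 0 - e.symm v 0| ≤ 2 * δ * r := by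
    rw [abs_le]; constructor <;> linarith [hu.1.1, hu.1.2, hv.1.1, hv.1.2]
  have h1 : |e.symm u 1 - e.symm v 1| ≤ δ * r := by
    rw [abs_le]; constructor <;> linarith [hu.2.1, hu.2.2, hv.2.1, hv.2.2]
  linarith

lemma dist_tiltedBox_le {p : ℝ × ℝ} {u v : Plane} (hu : u ∈ tiltedBox e p r)
    (hv : v ∈ tiltedBox e p r) : dist u v ≤ 2 * r := by
  simp only [tiltedBox, Set.mem_ofPred_eq, Set.mem_Ico] at hu hv
  refine (dist_le_abs_symm_add e u v).trans ?_
  have h0 : |e.symm u 0 - e.symm v 0| ≤ r := by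
    rw [abs_le]; constructor <;> linarith [hu.1.1, hu.1.2, hv.1.1, hv.1.2]
  have h1 : |e.symm u 1 - e.symm v 1| ≤ r := by
    rw [abs_le]; constructor <;> linarith [hu.2.1, hu.2.2, hv.2.1, hv.2.2]
  linarith

/-- The far part starts at the centre of the cell and has side at most `r / 12`, so `r / 2 - r / 12`
is a margin on every side. It makes node `b` isolated. -/
lemma le_dist_farPart (hr0 : 0 < r) (hδ : δ ≤ 1 / 12) {j : Fin N × Fin N} {u v : Plane}
    (hu : u ∈ farPart e s r δ j)
    (hv : v ∈ basePart e s r δ j ∨ v ∉ tiltedBox e (gridCorner s j) r) : r / 4 ≤ dist u v := by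
  simp only [farPart, tiltedBox, Set.mem_ofPred_eq, Set.mem_Ico, Prod.fst_add,
      Prod.snd_add] at hu
  have hδr : δ * r ≤ r / 12 := by nlinarith
  have d0 := abs_symm_sub_le_dist e u v 0
  have d1 := abs_symm_sub_le_dist e u v 1
  rw [abs_le] at d0 d1
  rcases hv with hv | hv
  · simp only [basePart, tiltedBox, Set.mem_ofPred_eq, Set.mem_Ico] at hv
    linarith [hu.1.1, hv.1.2]
  · by_contra hlt
    push Not at hlt
    refine hv ?_
    simp only [tiltedBox, Set.mem_ofPred_eq, Set.mem_Ico]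
    refine ⟨⟨?_, ?_⟩, ?_, ?_⟩ <;> linarith [hu.1.1, hu.1.2, hu.2.1, hu.2.2]

/-- The reason for placing the grid in the central half: an edge from a cell to a node outside `S₀`
is long. -/
lemma le_dist_of_central {x y : Plane}
    (hx : ∀ i, s / 4 ≤ e.symm x i ∧ e.symm x i ≤ 3 * s / 4)
    (hy : y ∉ e '' {y : Plane | ∀ i, y i ∈ Set.Icc (0 : ℝ) s}) : s / 4 ≤ dist x y := by
  rw [mem_image_square_iff] at hy
  push Not at hy
  obtain ⟨i, hi⟩ := hy
  by_contra hlt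
  push Not at hlt
  have d := abs_le.1 (abs_symm_sub_le_dist e x y i)
  exact hi ⟨by linarith [(hx i).1], by linarith [(hx i).2]⟩

end Grid

/-! ### Measurability -/

lemma measurable_cycleWeight {h : Plane → Plane → ℝ} (hh : Measurable (Function.uncurry h))
    (α : ℝ) {n : ℕ} (σ : Equiv.Perm (Fin n)) : Measurable fun x => cycleWeight h α x σ :=
  Finset.measurable_sum _ fun k _ => by
    have hpair : Measurable fun x : Fin n → Plane => (x (σ k), x (σ (finRotate n k))) :=
      (measurable_pi_apply _).prodMk (measurable_pi_apply _)
    exact (hh.comp hpair).pow_const α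

lemma measurable_tspWeight {h : Plane → Plane → ℝ} (hh : Measurable (Function.uncurry h))
    (α : ℝ) {n : ℕ} : Measurable fun x : Fin n → Plane => tspWeight h α x := by
  have e : (fun x : Fin n → Plane => tspWeight h α x) =
      (Finset.univ : Finset (Equiv.Perm (Fin n))).inf' Finset.univ_nonempty
        (fun σ x => cycleWeight h α x σ) := by
    ext x
    rw [Finset.inf'_apply]
    rfl
  rw [e]
  exact Finset.inf'_induction _ _ (fun _ h₁ _ h₂ => h₁.inf h₂) fun σ _ => measurable_cycleWeight hh α σ

lemma tspWeight_nonneg {S : Set Plane} {h : Plane → Plane → ℝ}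
    (hh : ∀ x ∈ S, ∀ y ∈ S, 0 ≤ h x y) (α : ℝ) {n : ℕ} {x : Fin n → Plane} (hx : ∀ i, x i ∈ S) :
    0 ≤ tspWeight h α x :=
  (Finset.le_inf'_iff _ _).2 fun _ _ =>
    Finset.sum_nonneg fun _ _ => Real.rpow_nonneg (hh _ (hx _) _ (hx _)) _

/-- The configurations in which, in every optimal cycle, the successor of the node `b` lies
outside `S₀`. -/
def farSuccessor (h : Plane → Plane → ℝ) (α : ℝ) (S₀ : Set Plane) {n : ℕ} (b : Fin n) :
    Set (Fin n → Plane) :=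
  {x | ∀ σ : Equiv.Perm (Fin n), tspWeight h α x = cycleWeight h α x σ →
    x (σ (finRotate n (σ.symm b))) ∉ S₀}

/-- Quantifying over all optimal cycles avoids a measurable choice of one: the event is a finite
intersection over permutations. -/
lemma measurableSet_farSuccessor {h : Plane → Plane → ℝ} (hh : Measurable (Function.uncurry h))
    (α : ℝ) {S₀ : Set Plane} (hS₀ : MeasurableSet S₀) {n : ℕ} (b : Fin n) :
    MeasurableSet (farSuccessor h α S₀ b) := by
  have e : farSuccessor h α S₀ b = ⋂ σ : Equiv.Perm (Fin n),
      ({x | tspWeight h α x = cycleWeight h α x σ}ᶜ ∪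
        (fun x : Fin n → Plane => x (σ (finRotate n (σ.symm b)))) ⁻¹' S₀ᶜ) := by
    ext x
    simp only [farSuccessor, Set.mem_ofPred_eq, Set.mem_iInter, Set.mem_union, Set.mem_compl_iff,
      Set.mem_preimage]
    exact forall_congr' fun σ => imp_iff_not_or
  rw [e]
  exact MeasurableSet.iInter fun σ =>
    (measurableSet_eq_fun (measurable_tspWeight hh α) (measurable_cycleWeight hh α σ)).compl.union
      (measurable_pi_apply _ hS₀.compl)

/-! ### The variance bound -/

section Variance

variable {h : Plane → Plane → ℝ} {α : ℝ} {e : Plane ≃ᵃⁱ[ℝ] Plane} {s : ℝ} {S S₀ : Set Plane}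

/-- Off the bad event, reinsertion uses up at most half of the saving `(1 - α) (r / 4)^α`, by `hδα`.
On it, the move has length at most `2 r` and costs at most `2 (2 r)^α`, which is why `C` is `κ` plus
this cost. -/
lemma tspWeight_update_le_of_grid
    (hh_S₀ : ∀ u ∈ S, ∀ v ∈ S, u ∈ S₀ ∨ v ∈ S₀ → h u v = dist u v)
    (hα₀ : 0 < α) (hα₁ : α < 1) (hS₀S : S₀ ⊆ S) {r δ : ℝ} (hr0 : 0 < r) {N : ℕ}
    (hc : IsCellFamily S₀ (basePart (N := N) e s r δ) (farPart e s r δ) (nearPart e s r δ)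
      (fun j => tiltedBox e (gridCorner s j) r))
    (hδ : δ ≤ 1 / 12)
    (hδα : 2 * (3 * δ) ^ α ≤ (1 - α) / 2 * (1 / 4) ^ α)
    {n : ℕ} {x : Fin n → Plane} (hx : ∀ i, x i ∈ S) {j : Fin N × Fin N} {a b : Fin n}
    (hab : a ≠ b) (ha : x a ∈ basePart e s r δ j) (hb : x b ∈ farPart e s r δ j)
    (hl : ∀ l, l ≠ a → l ≠ b → x l ∉ tiltedBox e (gridCorner s j) r) {v : Plane}
    (hv : v ∈ nearPart e s r δ j) :
    tspWeight h α (Function.update x b v) ≤ tspWeight h α x -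
      ((1 - α) / 2 * (1 / 4) ^ α * r ^ α - ((1 - α) / 2 * (1 / 4) ^ α + 2 * 2 ^ α) * r ^ α *
        (farSuccessor h α S₀ b).indicator 1 x) := by
  have hv₀ : v ∈ S₀ := hc.subQ j (hc.subB' j hv)
  have hb₀ : x b ∈ S₀ := hc.subQ j (hc.subB j hb)
  have ha₀ : x a ∈ S₀ := hc.subQ j (hc.subA j ha)
  by_cases hL : x ∈ farSuccessor h α S₀ b
  · rw [Set.indicator_of_mem hL, Pi.one_apply, mul_one]
    have h1 := tspWeight_update_le hh_S₀ hα₀ hα₁ hx (hS₀S hv₀) hb₀ hv₀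
    have h2 : dist (x b) v ^ α ≤ 2 ^ α * r ^ α := by
      rw [← Real.mul_rpow zero_le_two hr0.le]
      exact Real.rpow_le_rpow dist_nonneg (dist_tiltedBox_le (hc.subB j hb) (hc.subB' j hv)) hα₀.le
    linarith
  · rw [Set.indicator_of_notMem hL, mul_zero, sub_zero]
    simp only [farSuccessor, Set.mem_ofPred_eq, not_forall, not_not] at hL
    obtain ⟨σ, hσ, hnext⟩ := hL
    have hiso : ∀ i, i ≠ b → r / 4 ≤ dist (x b) (x i) := by
      intro i hi
      refine le_dist_farPart hr0 hδ hb ?_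
      by_cases hia : i = a
      · exact Or.inl (hia ▸ ha)
      · exact Or.inr (hl i hia hi)
    have h1 := tspWeight_update_le_of_isolated hh_S₀ hα₀ hα₁ hx hab (hS₀S hv₀) ha₀ hb₀ hv₀
      (by positivity : 0 < r / 4) hiso hσ hnext
    have h2 : dist v (x a) ^ α ≤ (3 * δ) ^ α * r ^ α := by
      have hδ3 : 0 ≤ 3 * δ := by
        have := dist_nonneg.trans (dist_basePart_nearPart_le hv ha)
        exact nonneg_of_mul_nonneg_left this hr0
      rw [← Real.mul_rpow hδ3 hr0.le]
      exact Real.rpow_le_rpow dist_nonneg (dist_basePart_nearPart_le hv ha) hα₀.le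
    have h3 : (r / 4) ^ α = (1 / 4) ^ α * r ^ α := by
      rw [← Real.mul_rpow (by norm_num) hr0.le]
      congr 1
      ring
    have h4 := mul_le_mul_of_nonneg_right hδα (Real.rpow_nonneg hr0.le α)
    rw [h3] at h1
    linarith

/-- In one fixed optimal cycle each counted node starts an edge of weight at least `(s / 4)^α`, so a
Markov-type count applies. -/
lemma ncard_farSuccessor_le (hs : 0 < s)
    (hh : ∀ x ∈ S, ∀ y ∈ S, 0 ≤ h x y)
    (hS₀ : S₀ = e '' {y : Plane | ∀ i, y i ∈ Set.Icc (0 : ℝ) s})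
    (hh_S₀ : ∀ u ∈ S, ∀ v ∈ S, u ∈ S₀ ∨ v ∈ S₀ → h u v = dist u v) (hα₀ : 0 < α)
    {r δ : ℝ} {N : ℕ} (hr : r ≤ s / (2 * N))
    (hc : IsCellFamily S₀ (basePart (N := N) e s r δ) (farPart e s r δ) (nearPart e s r δ)
      (fun j => tiltedBox e (gridCorner s j) r))
    {n : ℕ} {x : Fin n → Plane} (hx : ∀ i, x i ∈ S) :
    (Set.ncard {b | x ∈ farSuccessor h α S₀ b ∧
      ∃ j : Fin N × Fin N, x b ∈ farPart e s r δ j} : ℝ) ≤ tspWeight h α x / (s / 4) ^ α := by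
  classical
  obtain ⟨σ, hσ⟩ := exists_tspWeight_eq h α x
  rw [le_div_iff₀ (Real.rpow_pos_of_pos (by positivity) _), hσ, Set.ncard_eq_toFinset_card']
  refine card_mul_le_cycleWeight hh hx σ _ fun b hb => ?_
  simp only [Set.mem_toFinset, Set.mem_ofPred_eq] at hb
  obtain ⟨hb1, j, hj⟩ := hb
  have hcen := tiltedBox_gridCorner_central hs hr j (hc.subB j hj)
  have hnext := hb1 σ hσ
  rw [hh_S₀ _ (hx b) _ (hx _) (Or.inl (hc.subQ j (hc.subB j hj)))]
  refine Real.rpow_le_rpow (by positivity) (le_dist_of_central hcen ?_) hα₀.le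
  rwa [← hS₀]

lemma measurable_tspWeight_indicator (hh : Measurable (Function.uncurry h))
    (hS : MeasurableSet S) (n : ℕ) :
    Measurable (Set.indicator {x : Fin n → Plane | ∀ i, x i ∈ S} fun x => tspWeight h α x) := by
  refine (measurable_tspWeight hh α).indicator ?_
  have : {x : Fin n → Plane | ∀ i, x i ∈ S} = Set.univ.pi fun _ => S := by
    ext x; simp
  rw [this]
  exact MeasurableSet.univ_pi fun _ => hS

lemma sq_le_variance_tspWeight_mul {f : Plane → ℝ} [IsProbabilityMeasure (nodeLaw f)]
    {ε₁ ε₂ : ℝ} (hε₁ : 0 < ε₁) (hε₂ : 0 < ε₂)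
    (hf_bounds : ∀ x ∈ unitSquare, ε₁ ≤ f x ∧ f x ≤ ε₂)
    (hh : Measurable (Function.uncurry h))
    (hh0 : ∀ x ∈ unitSquare, ∀ y ∈ unitSquare, 0 ≤ h x y)
    (hs : 0 < s) (hS₀ : S₀ = e '' {y : Plane | ∀ i, y i ∈ Set.Icc (0 : ℝ) s})
    (hS₀_sub : S₀ ⊆ unitSquare)
    (hh_S₀ : ∀ u ∈ unitSquare, ∀ v ∈ unitSquare, u ∈ S₀ ∨ v ∈ S₀ → h u v = dist u v)
    (hα₀ : 0 < α) (hα₁ : α < 1) {δ : ℝ} (hδ0 : 0 < δ) (hδ : δ ≤ 1 / 12)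
    (hδα : 2 * (3 * δ) ^ α ≤ (1 - α) / 2 * (1 / 4) ^ α)
    {r : ℝ} {N n : ℕ} (hr0 : 0 < r) (hr : r ≤ s / (2 * N)) (hrn : n * (ε₂ * r ^ 2) ≤ 1 / 2)
    {K : ℝ} (hK : ∀ x : Fin n → Plane, (∀ i, x i ∈ unitSquare) → tspWeight h α x ≤ K)
    (hK0 : 0 ≤ K) {y : ℝ} (hy0 : 0 ≤ y)
    (hy : y ≤ ε₁ * (δ * r) ^ 2 * ((1 - α) / 2 * (1 / 4) ^ α * r ^ α) *
      ((N * N : ℝ) * (n * n - n : ℕ) * (ε₁ * (δ * r) ^ 2 * (ε₁ * (δ * r) ^ 2) / 2)) -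
      ε₂ * (δ * r) ^ 2 * (((1 - α) / 2 * (1 / 4) ^ α + 2 * 2 ^ α) * r ^ α) *
        (K / (s / 4) ^ α)) :
    y ^ 2 ≤ variance (fun x : Fin n → Plane => tspWeight h α x)
        (Measure.pi fun _ : Fin n => nodeLaw f) *
      ((N * N : ℝ) * (n * n - n : ℕ) * (2 * (ε₂ * (δ * r) ^ 2) ^ 4)) := by
  have hc : IsCellFamily S₀ (basePart (N := N) e s r δ) (farPart e s r δ) (nearPart e s r δ)
      (fun j => tiltedBox e (gridCorner s j) r) :=
    isCellFamily_grid hs hr0 hr hδ0 hδ hS₀.ge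
  have hcS : IsCellFamily unitSquare (basePart (N := N) e s r δ) (farPart e s r δ)
      (nearPart e s r δ) (fun j => tiltedBox e (gridCorner s j) r) :=
    { hc with subQ := fun j => (hc.subQ j).trans hS₀_sub }
  have hS₀m : MeasurableSet S₀ := by
    have : S₀ = ⋂ i : Fin 2, {x : Plane | e.symm x i ∈ Set.Icc (0 : ℝ) s} := by
      ext x
      rw [hS₀, mem_image_square_iff]
      simp
    rw [this]
    exact MeasurableSet.iInter fun i => measurable_symm_apply e i measurableSet_Icc
  have hS := ae_mem_unitSquare f
  set D : Set (Fin n → Plane) := {x | ∀ i, x i ∈ unitSquare} with hD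
  -- The weight is controlled only for nodes in the unit square. Cutting it off elsewhere changes it
  -- on a null set and makes it bounded everywhere.
  set T : (Fin n → Plane) → ℝ := D.indicator fun x => tspWeight h α x with hT
  have hTx : ∀ x, (∀ i, x i ∈ unitSquare) → T x = tspWeight h α x := fun x hx =>
    Set.indicator_of_mem (s := D) hx _
  have hTK : ∀ x, |T x| ≤ K := by
    intro x
    by_cases hx : x ∈ D
    · rw [hTx x hx, abs_of_nonneg (tspWeight_nonneg hh0 α hx)]
      exact hK x hx
    · rw [hT, Set.indicator_of_notMem hx, abs_zero]
      exact hK0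
  have hvar : variance T (Measure.pi fun _ : Fin n => nodeLaw f) =
      variance (fun x : Fin n → Plane => tspWeight h α x)
        (Measure.pi fun _ : Fin n => nodeLaw f) := by
    refine variance_congr ?_
    have hall : ∀ᵐ x ∂(Measure.pi fun _ : Fin n => nodeLaw f), ∀ i, x i ∈ unitSquare :=
      ae_all_iff.2 fun i =>
        (measurePreserving_eval (fun _ : Fin n => nodeLaw f) i).quasiMeasurePreserving.ae hS
    exact hall.mono fun x hx => hTx x hx
  have hδr : 0 ≤ δ * r := by positivity
  have hα2 : 0 < (1 - α) / 2 := by linarith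
  have hbA := fun j : Fin N × Fin N => nodeLaw_tiltedBox_bounds hε₁.le hf_bounds hε₂.le e _ hδr
    (((hcS.subA j).trans (hcS.subQ j) : basePart e s r δ j ⊆ unitSquare))
  have hbB := fun j : Fin N × Fin N => nodeLaw_tiltedBox_bounds hε₁.le hf_bounds hε₂.le e _ hδr
    (((hcS.subB j).trans (hcS.subQ j) : farPart e s r δ j ⊆ unitSquare))
  have hbB' := fun j : Fin N × Fin N => nodeLaw_tiltedBox_bounds hε₁.le hf_bounds hε₂.le e _ hδr
    (((hcS.subB' j).trans (hcS.subQ j) : nearPart e s r δ j ⊆ unitSquare))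
  have hbQ := fun j : Fin N × Fin N => nodeLaw_tiltedBox_bounds hε₁.le hf_bounds hε₂.le e _ hr0.le
    (hcS.subQ j)
  have hJ : (Fintype.card (Fin N × Fin N) : ℝ) = N * N := by simp
  have key := hcS.sq_le_variance_mul (nodeLaw f) hS (T := T)
    (measurable_tspWeight_indicator hh measurableSet_unitSquare n) hTK
    (L := farSuccessor h α S₀) (fun b => measurableSet_farSuccessor hh α hS₀m b)
    (m := ε₁ * (δ * r) ^ 2) (M := ε₂ * (δ * r) ^ 2) (by positivity)
    (fun j => (hbA j).1) (fun j => (hbB j).1) (fun j => (hbB' j).1)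
    (fun j => (hbA j).2) (fun j => (hbB j).2) (fun j => (hbB' j).2) (by positivity)
    (fun j => (mul_le_mul_of_nonneg_left (hbQ j).2 (Nat.cast_nonneg n)).trans hrn)
    (κ := (1 - α) / 2 * (1 / 4) ^ α * r ^ α)
    (C := ((1 - α) / 2 * (1 / 4) ^ α + 2 * 2 ^ α) * r ^ α)
    (Λ := K / (s / 4) ^ α) (by positivity) (by positivity)
    (fun x hx j a b hab ha hb hl v hv => by
      rw [hTx x hx, hTx]
      · exact tspWeight_update_le_of_grid hh_S₀ hα₀ hα₁ hS₀_sub hr0 hc hδ hδα hx hab ha hb hl hv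
      · intro i
        by_cases hi : i = b
        · subst hi
          simpa using hcS.subQ j (hcS.subB' j hv)
        · simpa [Function.update_of_ne hi] using hx i)
    (fun x hx => (ncard_farSuccessor_le hs hh0 hS₀ hh_S₀ hα₀ hr hc hx).trans
      (div_le_div_of_nonneg_right (hK x hx) (by positivity)))
  rw [hJ, hvar] at key
  exact (pow_le_pow_left₀ hy0 hy 2).trans (key (hy0.trans hy))

end Variance

/-! ### Choice of the constants and scaling in `n`. -/

lemma exists_part_side {α : ℝ} (hα₀ : 0 < α) (hα₁ : α < 1) :
    ∃ δ : ℝ, 0 < δ ∧ δ ≤ 1 / 12 ∧ 2 * (3 * δ) ^ α ≤ (1 - α) / 2 * (1 / 4) ^ α := by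
  have hb : 0 < (1 - α) / 4 := by linarith
  -- With `δ = q / 12` the required inequality becomes an equality.
  set q : ℝ := ((1 - α) / 4) ^ α⁻¹ with hq
  have hq0 : 0 < q := Real.rpow_pos_of_pos hb _
  have hq1 : q ≤ 1 := Real.rpow_le_one hb.le (by linarith) (by positivity)
  refine ⟨q / 12, by positivity, by linarith, ?_⟩
  have e1 : 3 * (q / 12) = (1 / 4) * q := by ring
  rw [e1, Real.mul_rpow (by norm_num) hq0.le, hq, Real.rpow_inv_rpow hb.le hα₀.ne']
  exact le_of_eq (by ring)

lemma sqrt_grid_bounds {n : ℕ} (hn : 1 ≤ n) :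
    0 < Nat.sqrt n ∧ (Nat.sqrt n * Nat.sqrt n : ℝ) ≤ n ∧
      (n : ℝ) ≤ 4 * (Nat.sqrt n * Nat.sqrt n) := by
  have h0 : 0 < Nat.sqrt n := Nat.sqrt_pos.2 hn
  have h1 := Nat.sqrt_le n
  have h2 := Nat.lt_succ_sqrt n
  refine ⟨h0, by exact_mod_cast h1, ?_⟩
  have : n ≤ 4 * (Nat.sqrt n * Nat.sqrt n) := by
    simp only [Nat.succ_eq_add_one] at h2
    nlinarith
  exact_mod_cast this

/-- For `r = θ / √n`, the first bound makes the cells fit in the grid and the second makes the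
expected number of nodes in a cell at most `1 / 2`. -/
lemma exists_cell_scale {s ε₂ : ℝ} (hs : 0 < s) (hε₂ : 0 < ε₂) :
    ∃ θ : ℝ, 0 < θ ∧ θ ≤ s / 2 ∧ ε₂ * θ ^ 2 ≤ 1 / 2 := by
  refine ⟨min (s / 2) (min 1 (1 / (2 * ε₂))), by positivity, min_le_left _ _, ?_⟩
  set θ := min (s / 2) (min 1 (1 / (2 * ε₂)))
  have h0 : 0 < θ := by positivity
  have h1 : θ ≤ 1 := (min_le_right _ _).trans (min_le_left _ _)
  have h2 : θ ≤ 1 / (2 * ε₂) := (min_le_right _ _).trans (min_le_right _ _)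
  have h3 : θ ^ 2 ≤ 1 / (2 * ε₂) := by
    calc θ ^ 2 = θ * θ := sq θ
      _ ≤ 1 * (1 / (2 * ε₂)) := by gcongr
      _ = 1 / (2 * ε₂) := one_mul _
  calc ε₂ * θ ^ 2 ≤ ε₂ * (1 / (2 * ε₂)) := by gcongr
    _ = 1 / 2 := by field_simp

lemma cube_bounds {n q : ℝ} (hn : 2 ≤ n) (hq : q ≤ n) (hn' : n ≤ 4 * q) :
    n ^ 3 / 8 ≤ q * (n * n - n) ∧ q * (n * n - n) ≤ n ^ 3 := by
  have h2 : n * n / 2 ≤ n * n - n := by nlinarith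
  constructor
  · calc n ^ 3 / 8 = n / 4 * (n * n / 2) := by ring
      _ ≤ q * (n * n - n) := by gcongr <;> linarith
  · calc q * (n * n - n) ≤ n * (n * n) := by gcongr <;> nlinarith
      _ = n ^ 3 := by ring

theorem theorem3
    {Ω : Type*} [MeasurableSpace Ω] (P : Measure Ω) [IsProbabilityMeasure P]
    -- the density of the nodes, bounded away from zero and infinity on the unit square
    (f : Plane → ℝ) (hf : Measurable f) (ε₁ ε₂ : ℝ) (hε₁ : 0 < ε₁)
    (hf_bounds : ∀ x ∈ unitSquare, ε₁ ≤ f x ∧ f x ≤ ε₂)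
    -- the i.i.d. nodes
    (X : ℕ → Ω → Plane) (hX : ∀ i, Measurable (X i)) (hX_indep : iIndepFun X P)
    (hX_law : ∀ i, P.map (X i) = nodeLaw f)
    -- the edge weight function, comparable with the Euclidean distance on the unit square
    (h : Plane → Plane → ℝ) (hh : Measurable (Function.uncurry h))
    (hh_symm : ∀ x ∈ unitSquare, ∀ y ∈ unitSquare, h x y = h y x)
    (c₁ c₂ : ℝ) (hc₁ : 0 < c₁) (hc₂ : 0 < c₂)
    (hh_bounds : ∀ x ∈ unitSquare, ∀ y ∈ unitSquare,
      c₁ * dist x y ≤ h x y ∧ h x y ≤ c₂ * dist x y)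
    -- a square such that every edge with an endpoint in it has its Euclidean length
    (S₀ : Set Plane) (s₀ : ℝ) (hs₀ : 0 < s₀) (hS₀ : IsSquareOfSide s₀ S₀)
    (hS₀_sub : S₀ ⊆ unitSquare)
    (hh_S₀ : ∀ u ∈ unitSquare, ∀ v ∈ unitSquare, u ∈ S₀ ∨ v ∈ S₀ → h u v = dist u v)
    -- the edge weight exponent
    (α : ℝ) (hα₀ : 0 < α) (hα₁ : α < 1) :
    ∃ D : ℝ, 0 < D ∧ ∀ᶠ n : ℕ in atTop,
      D * (n : ℝ) ^ (1 - α) ≤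
        variance (fun ω => tspWeight h α (fun i : Fin n => X i ω)) P := by
  obtain ⟨e, hS₀⟩ := hS₀
  have hprob : IsProbabilityMeasure (nodeLaw f) :=
    hX_law 0 ▸ Measure.isProbabilityMeasure_map (hX 0).aemeasurable
  have hε₂ : 0 < ε₂ := by
    have h0 : (0 : Plane) ∈ unitSquare := fun i => by simp [Set.mem_Icc]
    exact hε₁.trans_le ((hf_bounds 0 h0).1.trans (hf_bounds 0 h0).2)
  have hh0 : ∀ x ∈ unitSquare, ∀ y ∈ unitSquare, 0 ≤ h x y := fun x hx y hy =>
    (mul_nonneg hc₁.le dist_nonneg).trans (hh_bounds x hx y hy).1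
  obtain ⟨δ, hδ0, hδ, hδα⟩ := exists_part_side hα₀ hα₁
  obtain ⟨θ, hθ0, hθs, hθε⟩ := exists_cell_scale hs₀ hε₂
  set m₀ : ℝ := ε₁ * (δ * θ) ^ 2 with hm₀
  set M₀ : ℝ := ε₂ * (δ * θ) ^ 2 with hM₀
  set κ₀ : ℝ := (1 - α) / 2 * (1 / 4) ^ α with hκ₀
  set C₀ : ℝ := κ₀ + 2 * 2 ^ α with hC₀
  set d : ℝ := (s₀ / 4) ^ α with hd
  have hm₀0 : 0 < m₀ := by positivity
  have hM₀0 : 0 < M₀ := by positivity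
  have hκ₀0 : 0 < κ₀ := mul_pos (by linarith) (by positivity)
  have hC₀0 : 0 < C₀ := by positivity
  have hd0 : 0 < d := by positivity
  -- The main term is at least `2 g r^α`: a factor `1 / 8` from the number of cells and pairs, and
  -- `1 / 2` from the other nodes avoiding the cell. `η` is chosen so that the error term is exactly
  -- `g r^α`.
  set g : ℝ := m₀ ^ 3 * κ₀ / 32 with hg
  have hg0 : 0 < g := by positivity
  set η : ℝ := g * d / (2 * (M₀ * C₀)) with hη
  have hη0 : 0 < η := by positivity
  obtain ⟨Cη, hCη0, hCη⟩ := exists_tspWeight_le isBounded_unitSquare hc₂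
    (fun x hx y hy => ⟨hh0 x hx y hy, (hh_bounds x hx y hy).2⟩) hα₀ hη0
  refine ⟨(θ ^ 2) ^ α * g ^ 2 / (2 * M₀ ^ 4), by positivity, ?_⟩
  filter_upwards [eventually_ge_atTop 2, eventually_ge_atTop (Nat.ceil (Cη / η))] with n hn hnC
  have hn0 : (0 : ℝ) < n := by exact_mod_cast (by omega : 0 < n)
  have hnC' : Cη ≤ η * n := by
    have := (Nat.le_ceil (Cη / η)).trans (by exact_mod_cast hnC : (Nat.ceil (Cη / η) : ℝ) ≤ n)
    rwa [div_le_iff₀ hη0, mul_comm] at this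
  obtain ⟨hN0, hNn, hnN⟩ := sqrt_grid_bounds (by omega : 1 ≤ n)
  set N := Nat.sqrt n with hN
  have hN0' : (0 : ℝ) < N := by exact_mod_cast hN0
  set r : ℝ := θ / Real.sqrt n with hr
  have hsq0 : 0 < Real.sqrt n := Real.sqrt_pos.2 hn0
  have hr0 : 0 < r := div_pos hθ0 hsq0
  have hr2 : r ^ 2 = θ ^ 2 / n := by rw [hr, div_pow, Real.sq_sqrt hn0.le]
  have hNs : (N : ℝ) ≤ Real.sqrt n := Real.le_sqrt_of_sq_le (by rw [sq]; exact hNn)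
  have hrN : r ≤ s₀ / (2 * N) := by
    calc r ≤ (s₀ / 2) / N := div_le_div₀ (by positivity) hθs hN0' hNs
      _ = s₀ / (2 * N) := by rw [div_div]
  have hmr : ε₁ * (δ * r) ^ 2 = m₀ / n := by rw [hm₀, mul_pow, mul_pow, hr2]; ring
  have hMr : ε₂ * (δ * r) ^ 2 = M₀ / n := by rw [hM₀, mul_pow, mul_pow, hr2]; ring
  have hcast : ((n * n - n : ℕ) : ℝ) = n * n - n := by
    rw [Nat.cast_sub (Nat.le_mul_self n)]; push_cast; ring
  have hρ : 0 < r ^ α := Real.rpow_pos_of_pos hr0 _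
  have hn2 : (2 : ℝ) ≤ n := by exact_mod_cast hn
  obtain ⟨hpairs, hpairs'⟩ := cube_bounds hn2 hNn hnN
  have hbound := sq_le_variance_tspWeight_mul (n := n) (y := g * r ^ α) hε₁ hε₂ hf_bounds hh hh0 hs₀
    hS₀ hS₀_sub hh_S₀ hα₀ hα₁ hδ0 hδ hδα hr0 hrN
    (by rw [hr2]; calc (n : ℝ) * (ε₂ * (θ ^ 2 / n)) = ε₂ * θ ^ 2 := by field_simp
          _ ≤ 1 / 2 := hθε)
    -- For large `n` the additive constant `Cη` is absorbed in a second `η n`.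
    (K := 2 * η * n) (fun x hx => (hCη n x hx).trans (by linarith)) (by positivity)
    (by positivity) (by
      rw [hmr, hMr, hcast, ← hκ₀, ← hC₀, ← hd]
      have h1 : m₀ ^ 3 * κ₀ / 16 * r ^ α ≤ m₀ / n * (κ₀ * r ^ α) *
          (N * N * (n * n - n) * (m₀ / n * (m₀ / n) / 2)) := by
        calc m₀ ^ 3 * κ₀ / 16 * r ^ α = m₀ / n * (κ₀ * r ^ α) *
            ((n : ℝ) ^ 3 / 8 * (m₀ / n * (m₀ / n) / 2)) := by field_simp; ring
          _ ≤ _ := by gcongr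
      have h2 : M₀ / n * (C₀ * r ^ α) * (2 * η * n / d) = g * r ^ α := by
        rw [hη]; field_simp
      have h3 : m₀ ^ 3 * κ₀ / 16 * r ^ α = 2 * (g * r ^ α) := by rw [hg]; ring
      rw [h2]
      linarith)
  rw [hMr, hcast] at hbound
  have hmap : P.map (fun ω (i : Fin n) => X i ω) = Measure.pi fun _ : Fin n => nodeLaw f := by
    have hind : iIndepFun (fun i : Fin n => X i) P := hX_indep.precomp Fin.val_injective
    rw [(iIndepFun_iff_map_fun_eq_pi_map fun i : Fin n => (hX i).aemeasurable).1 hind]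
    simp only [hX_law]
  have hvar : variance (fun ω => tspWeight h α (fun i : Fin n => X i ω)) P =
      variance (fun x : Fin n → Plane => tspWeight h α x)
        (Measure.pi fun _ : Fin n => nodeLaw f) := by
    rw [← hmap, variance_map (measurable_tspWeight hh α).aemeasurable
      (measurable_pi_lambda _ fun i : Fin n => hX i).aemeasurable]
    rfl
  rw [hvar]
  set v := variance (fun x : Fin n → Plane => tspWeight h α x)
    (Measure.pi fun _ : Fin n => nodeLaw f) with hv
  have hv0 : 0 ≤ v := variance_nonneg _ _
  -- At most `n³` test functions, each of second moment at most `2 (M₀ / n)⁴`.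
  have h1 : (g * r ^ α) ^ 2 ≤ v * (2 * M₀ ^ 4 / n) := by
    refine hbound.trans (mul_le_mul_of_nonneg_left ?_ hv0)
    calc (N * N * (n * n - n) : ℝ) * (2 * (M₀ / n) ^ 4) ≤ n ^ 3 * (2 * (M₀ / n) ^ 4) := by gcongr
      _ = 2 * M₀ ^ 4 / n := by field_simp
  have h2 : (r ^ α) ^ 2 = (θ ^ 2) ^ α / (n : ℝ) ^ α := by
    rw [← Real.div_rpow (by positivity) hn0.le, ← hr2, ← Real.rpow_natCast, ← Real.rpow_natCast,
      ← Real.rpow_mul hr0.le, ← Real.rpow_mul hr0.le, mul_comm]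
  have h3 : (n : ℝ) ^ (1 - α) = n / (n : ℝ) ^ α := by
    rw [Real.rpow_sub hn0, Real.rpow_one]
  rw [mul_pow, h2] at h1
  have hnα : 0 < (n : ℝ) ^ α := Real.rpow_pos_of_pos hn0 _
  calc (θ ^ 2) ^ α * g ^ 2 / (2 * M₀ ^ 4) * (n : ℝ) ^ (1 - α)
      = g ^ 2 * ((θ ^ 2) ^ α / (n : ℝ) ^ α) * (n / (2 * M₀ ^ 4)) := by rw [h3]; field_simp
    _ ≤ v * (2 * M₀ ^ 4 / n) * (n / (2 * M₀ ^ 4)) := by gcongr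
    _ = v := by field_simp
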